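/- Let $p$ be an odd prime and write $[x,y]=xyx^{-1}y^{-1}$. Let $H=\langle a,b,c,d\rangle$ be the $p$-group of nilpotency class $2$ defined by the relations $$[[x,y],z]=1\ (x,y,z\in H),\quad a^p=[a,c],\quad b^p=[a,bcd],\quad c^p=[b,cd],\quad d^p=[b,d],$$ and let $H^p=\langle h^p : h\in H\rangle$. A $p$-group $G$ is called special if $Z(G)=G'=\Phi(G)$, and a group is called a Miller group if it is non-abelian and its automorphism group is abelian. The assignment $a\mapsto ad^p$, $b\mapsto b$, $c\mapsto c$, $d\mapsto d$ extends to an automorphism of $H$ which is central (it induces the identity on $H/Z(H)$) and not inner, and $\langle[a,b]\rangle$ and $\langle[a,d]\rangle$ are subgroups of $H'$ of order $p$ not contained in $H^p$. Let $M\le H'$ be a subgroup of order $p$ with $M\nsubseteq H^p$. Then there is an amalgamated semi-direct product $G_2=H\rtimes_M\langle w\rangle$, that is, a group $G_2$ containing $H$ as a normal subgroup and an element $w$ such that $G_2=H\langle w\rangle$ and $H\cap\langle w\rangle=M$, in which $w$ has order $p^3$ and $$waw^{-1}=ad^p,\quad wbw^{-1}=b,\quad wcw^{-1}=c,\quad wdw^{-1}=d.$$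 Every such group $G_2$ is a non-special $p$-group of order $p^{12}$, and: (1) if $M=\langle[a,b]\rangle$, then $G_2$ is a Miller group; (2) if $M=\langle[a,d]\rangle$, then $G_2$ is not a Miller group. -/

import Mathlib

universe u

open scoped commutatorElement

namespace MillerGroups

/-- The relators of the `p`-group `H` on the free generators `x₀ = a, x₁ = b, x₂ = c, x₃ = d`:
all triple commutators (nilpotency class at most two), together with
`a ^ p = [a, c]`, `b ^ p = [a, bcd]`, `c ^ p = [b, cd]`, `d ^ p = [b, d]`,
where `[x, y] = x y x⁻¹ y⁻¹`. -/
def relators (p : ℕ) : Set (FreeGroup (Fin 4)) :=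
  let a : FreeGroup (Fin 4) := FreeGroup.of 0
  let b : FreeGroup (Fin 4) := FreeGroup.of 1
  let c : FreeGroup (Fin 4) := FreeGroup.of 2
  let d : FreeGroup (Fin 4) := FreeGroup.of 3
  {r | ∃ x y z : FreeGroup (Fin 4), r = ⁅⁅x, y⁆, z⁆} ∪
    {a ^ p * ⁅a, c⁆⁻¹, b ^ p * ⁅a, b * c * d⁆⁻¹, c ^ p * ⁅b, c * d⁆⁻¹, d ^ p * ⁅b, d⁆⁻¹}

/-- The group `H = ⟨a, b, c, d⟩` of class two given by the relations above. -/
abbrev H (p : ℕ) : Type := PresentedGroup (relators p)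

/-- The generator `a` of `H`. -/
def a (p : ℕ) : H p := PresentedGroup.of 0

/-- The generator `b` of `H`. -/
def b (p : ℕ) : H p := PresentedGroup.of 1

/-- The generator `c` of `H`. -/
def c (p : ℕ) : H p := PresentedGroup.of 2

/-- The generator `d` of `H`. -/
def d (p : ℕ) : H p := PresentedGroup.of 3

/-- `G ^ p`, the subgroup generated by all `p`-th powers of elements of `G`. -/
def powSubgroup (p : ℕ) (G : Type u) [Group G] : Subgroup G :=
  Subgroup.closure (Set.range fun g : G => g ^ p)

/-- A special `p`-group: a `p`-group `G` with `Z(G) = G' = Φ(G)`. -/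
def IsSpecial (p : ℕ) (G : Type u) [Group G] : Prop :=
  IsPGroup p G ∧ Subgroup.center G = commutator G ∧ commutator G = frattini G

/-- A Miller group: a non-abelian group whose automorphism group is abelian. -/
def IsMiller (G : Type u) [Group G] : Prop :=
  (¬ ∀ x y : G, x * y = y * x) ∧ ∀ φ ψ : MulAut G, φ * ψ = ψ * φ

/-- A central automorphism: one inducing the identity on `G / Z(G)`. -/
def IsCentralAut {G : Type u} [Group G] (φ : MulAut G) : Prop :=
  ∀ x : G, x⁻¹ * φ x ∈ Subgroup.center G

/-- An inner automorphism. -/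
def IsInnerAut {G : Type u} [Group G] (φ : MulAut G) : Prop :=
  ∃ g : G, φ = MulAut.conj g

/-- `G = N ⋊_M K`: the group `G` is the amalgamated semi-direct product of its subgroup `N`
by its subgroup `K` over `M`. -/
structure IsAmalgamatedSemidirect {G : Type u} [Group G] (N K M : Subgroup G) : Prop where
  normal : N.Normal
  mul_eq : ∀ g : G, ∃ h ∈ N, ∃ k ∈ K, g = h * k
  inf_eq : N ⊓ K = M

/-- The subgroups over which one amalgamates: `M ≤ H'` of order `p` with `M ⊈ H ^ p`. -/
structure IsAdmissible (p : ℕ) (M : Subgroup (H p)) : Prop where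
  le_commutator : M ≤ commutator (H p)
  card_eq : Nat.card M = p
  not_le_pow : ¬ M ≤ powSubgroup p (H p)

/-- `G = H ⋊_M ⟨w⟩`, where `H` is regarded as a subgroup of `G` through the embedding `ι`,
`w` has order `p ^ 3` and acts on `H` by `a ↦ a d ^ p`, fixing `b`, `c`, `d`. -/
structure IsG₂ (p : ℕ) (M : Subgroup (H p)) (G : Type u) [Group G] (ι : H p →* G) (w : G) :
    Prop where
  injective : Function.Injective ι
  orderOf_eq : orderOf w = p ^ 3
  amalgam : IsAmalgamatedSemidirect ι.range (Subgroup.zpowers w) (M.map ι)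
  conj_a : w * ι (a p) * w⁻¹ = ι (a p * d p ^ p)
  conj_b : w * ι (b p) * w⁻¹ = ι (b p)
  conj_c : w * ι (c p) * w⁻¹ = ι (c p)
  conj_d : w * ι (d p) * w⁻¹ = ι (d p)

end MillerGroups

/-!
# Proof strategy

Everything is computed in explicit groups. A `Word ε` is an integer exponent vector of a collected
word `a ^ xa * b ^ xb * c ^ xc * d ^ xd * w ^ xw * [a,b] ^ ab * ⋯ * [c,d] ^ cd`, multiplied by
collection in class two with `[w,a] = [b,d] ^ ε`, and `Model p ε q μ` is its quotient by the words
that the power relations make trivial. That subgroup is explicit (`Word.relSubgroup`), and the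
quotient has the universal property of the presented group (`Model.lift`). Hence `H` is the model
with `ε = 0`, `q = 1`, `μ = 0` (`H_toModel_injective`), and every `G₂` is isomorphic to the model
with `ε = 1`, `q = p²`, where `w ^ p² = [a,b] ^ μ₀ ⋯ [c,d] ^ μ₅` generates `M`
(`IsG₂.exists_mulEquiv`); conversely these models are amalgamated products
(`isG₂_amalgamModel`). The order is then a count of normal forms, and `G₂` is not special because
`w ^ p` is central without lying in `G₂'`.

Suppose `M = ⟨[a,b]⟩`. An automorphism acts linearly on the space over `ZMod p` spanned by
`a, b, c, d, w`, and commutators and `p`-th powers become bilinear and linear maps on it. The images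
of `a, b, c, d` have `p`-th powers in `G₂'`, so they do not involve `w` modulo `p`. The image of `w`
commutes with those of `b, c, d`, so it is a power of `w`
(`eq_zero_of_commForm_eq_zero`). The relation `[w,a] = [b,d]` then shows that `⟨b, d⟩` is preserved,
and `w ^ p² ∈ ⟨[a,b]⟩` shows that `⟨a, b⟩` is preserved; comparing the power relations leaves only
the identity (`rigidity`). So every automorphism multiplies `a, b, c, d` by elements of `G₂'`, and
`w` by an element of `⟨w ^ p⟩ G₂'` (`exists_central_form`). Such automorphisms fix `G₂'` pointwise,
and therefore commute with one another.

Suppose `M = ⟨[a,d]⟩`, with `w ^ p² = [a,d] ^ k` and `k k' = 1` modulo `p`. Then `a ↦ a w ^ (p k')`,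
`b ↦ b w ^ (p k')`, `c ↦ c d`, `d ↦ d`, `w ↦ w` respects all relations, because the `p`-th power of
`w ^ (p k')` is the factor `[a,d]` that `c ↦ c d` contributes to `[a,c]` (`modelRel_shear`). This
automorphism moves `c` by the non-central element `d`, so it does not commute with conjugation
by `c`.
-/

namespace MillerGroups

/-! ### Collected words and the model groups -/

/-- Exponent vectors of collected words
`a ^ xa * b ^ xb * c ^ xc * d ^ xd * w ^ xw * [a,b] ^ ab * ⋯ * [c,d] ^ cd`.
The parameter `ε` of the group law records the relation `[w,a] = [b,d] ^ ε`; all other commutators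
of `w` with the generators are trivial. -/
@[ext]
structure Word (ε : ℤ) where
  xa : ℤ
  xb : ℤ
  xc : ℤ
  xd : ℤ
  xw : ℤ
  ab : ℤ
  ac : ℤ
  ad : ℤ
  bc : ℤ
  bd : ℤ
  cd : ℤ

namespace Word

variable {ε : ℤ}

instance : One (Word ε) := ⟨⟨0, 0, 0, 0, 0, 0, 0, 0, 0, 0, 0⟩⟩

/-- The product of two collected words, collected again. -/
instance : Mul (Word ε) := ⟨fun X Y =>
  ⟨X.xa + Y.xa, X.xb + Y.xb, X.xc + Y.xc, X.xd + Y.xd, X.xw + Y.xw,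
    X.ab + Y.ab - X.xb * Y.xa, X.ac + Y.ac - X.xc * Y.xa, X.ad + Y.ad - X.xd * Y.xa,
    X.bc + Y.bc - X.xc * Y.xb, X.bd + Y.bd - X.xd * Y.xb + ε * (X.xw * Y.xa),
    X.cd + Y.cd - X.xd * Y.xc⟩⟩

instance : Inv (Word ε) := ⟨fun X =>
  ⟨-X.xa, -X.xb, -X.xc, -X.xd, -X.xw,
    -X.ab - X.xb * X.xa, -X.ac - X.xc * X.xa, -X.ad - X.xd * X.xa,
    -X.bc - X.xc * X.xb, -X.bd - X.xd * X.xb + ε * (X.xw * X.xa), -X.cd - X.xd * X.xc⟩⟩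

section
variable (X Y : Word ε)

@[simp] lemma one_xa : (1 : Word ε).xa = 0 := rfl
@[simp] lemma one_xb : (1 : Word ε).xb = 0 := rfl
@[simp] lemma one_xc : (1 : Word ε).xc = 0 := rfl
@[simp] lemma one_xd : (1 : Word ε).xd = 0 := rfl
@[simp] lemma one_xw : (1 : Word ε).xw = 0 := rfl
@[simp] lemma one_ab : (1 : Word ε).ab = 0 := rfl
@[simp] lemma one_ac : (1 : Word ε).ac = 0 := rfl
@[simp] lemma one_ad : (1 : Word ε).ad = 0 := rfl
@[simp] lemma one_bc : (1 : Word ε).bc = 0 := rfl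
@[simp] lemma one_bd : (1 : Word ε).bd = 0 := rfl
@[simp] lemma one_cd : (1 : Word ε).cd = 0 := rfl
@[simp] lemma mul_xa : (X * Y).xa = X.xa + Y.xa := rfl
@[simp] lemma mul_xb : (X * Y).xb = X.xb + Y.xb := rfl
@[simp] lemma mul_xc : (X * Y).xc = X.xc + Y.xc := rfl
@[simp] lemma mul_xd : (X * Y).xd = X.xd + Y.xd := rfl
@[simp] lemma mul_xw : (X * Y).xw = X.xw + Y.xw := rfl
@[simp] lemma mul_ab : (X * Y).ab = X.ab + Y.ab - X.xb * Y.xa := rfl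
@[simp] lemma mul_ac : (X * Y).ac = X.ac + Y.ac - X.xc * Y.xa := rfl
@[simp] lemma mul_ad : (X * Y).ad = X.ad + Y.ad - X.xd * Y.xa := rfl
@[simp] lemma mul_bc : (X * Y).bc = X.bc + Y.bc - X.xc * Y.xb := rfl
@[simp] lemma mul_bd : (X * Y).bd = X.bd + Y.bd - X.xd * Y.xb + ε * (X.xw * Y.xa) := rfl
@[simp] lemma mul_cd : (X * Y).cd = X.cd + Y.cd - X.xd * Y.xc := rfl
@[simp] lemma inv_xa : X⁻¹.xa = -X.xa := rfl
@[simp] lemma inv_xb : X⁻¹.xb = -X.xb := rfl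
@[simp] lemma inv_xc : X⁻¹.xc = -X.xc := rfl
@[simp] lemma inv_xd : X⁻¹.xd = -X.xd := rfl
@[simp] lemma inv_xw : X⁻¹.xw = -X.xw := rfl
@[simp] lemma inv_ab : X⁻¹.ab = -X.ab - X.xb * X.xa := rfl
@[simp] lemma inv_ac : X⁻¹.ac = -X.ac - X.xc * X.xa := rfl
@[simp] lemma inv_ad : X⁻¹.ad = -X.ad - X.xd * X.xa := rfl
@[simp] lemma inv_bc : X⁻¹.bc = -X.bc - X.xc * X.xb := rfl
@[simp] lemma inv_bd : X⁻¹.bd = -X.bd - X.xd * X.xb + ε * (X.xw * X.xa) := rfl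
@[simp] lemma inv_cd : X⁻¹.cd = -X.cd - X.xd * X.xc := rfl

end

instance : Group (Word ε) :=
  Group.ofLeftAxioms (fun X Y Z => by ext <;> simp <;> ring) (fun X => by ext <;> simp)
    (fun X => by ext <;> simp <;> ring)

/-- In class two, `(x * y) ^ n = x ^ n * y ^ n * [y,x] ^ (n choose 2)`. -/
lemma pow_eq (X : Word ε) (n : ℕ) : X ^ n =
    ⟨n * X.xa, n * X.xb, n * X.xc, n * X.xd, n * X.xw,
      n * X.ab - n.choose 2 * (X.xb * X.xa), n * X.ac - n.choose 2 * (X.xc * X.xa),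
      n * X.ad - n.choose 2 * (X.xd * X.xa), n * X.bc - n.choose 2 * (X.xc * X.xb),
      n * X.bd - n.choose 2 * (X.xd * X.xb) + n.choose 2 * (ε * (X.xw * X.xa)),
      n * X.cd - n.choose 2 * (X.xd * X.xc)⟩ := by
  induction n with
  | zero => ext <;> simp
  | succ n ih =>
    rw [pow_succ, ih]
    have : (n + 1).choose 2 = n + n.choose 2 := by
      rw [Nat.choose_succ_succ' n 1, Nat.choose_one_right]
    ext <;> simp [this] <;> ring

lemma commutator_eq (X Y : Word ε) : ⁅X, Y⁆ =
    ⟨0, 0, 0, 0, 0, X.xa * Y.xb - X.xb * Y.xa, X.xa * Y.xc - X.xc * Y.xa,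
      X.xa * Y.xd - X.xd * Y.xa, X.xb * Y.xc - X.xc * Y.xb,
      X.xb * Y.xd - X.xd * Y.xb + ε * (X.xw * Y.xa - X.xa * Y.xw),
      X.xc * Y.xd - X.xd * Y.xc⟩ := by
  rw [commutatorElement_def]
  ext <;> simp <;> ring

/-- The central word `[a,b] ^ u₀ * [a,c] ^ u₁ * [a,d] ^ u₂ * [b,c] ^ u₃ * [b,d] ^ u₄ * [c,d] ^ u₅`. -/
def ofComm (u : Fin 6 → ℤ) : Word ε := ⟨0, 0, 0, 0, 0, u 0, u 1, u 2, u 3, u 4, u 5⟩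

/-- The words that the relations `a ^ p = [a,c]`, `b ^ p = [a,b][a,c][a,d]`, `c ^ p = [b,c][b,d]`,
`d ^ p = [b,d]`, `w ^ q = [a,b] ^ μ₀ ⋯ [c,d] ^ μ₅` and "commutators have order dividing `p`"
make trivial. -/
def relSubgroup (p : ℕ) (ε q : ℤ) (μ : Fin 6 → ℤ) : Subgroup (Word ε) where
  carrier := {X | ∃ y₀ y₁ y₂ y₃ n : ℤ,
    (X.xa = p * y₀ ∧ X.xb = p * y₁ ∧ X.xc = p * y₂ ∧ X.xd = p * y₃ ∧ X.xw = q * n) ∧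
    (X.ab + y₁ + n * μ 0 : ZMod p) = 0 ∧ (X.ac + y₀ + y₁ + n * μ 1 : ZMod p) = 0 ∧
    (X.ad + y₁ + n * μ 2 : ZMod p) = 0 ∧ (X.bc + y₂ + n * μ 3 : ZMod p) = 0 ∧
    (X.bd + y₂ + y₃ + n * μ 4 : ZMod p) = 0 ∧ (X.cd + n * μ 5 : ZMod p) = 0}
  one_mem' := ⟨0, 0, 0, 0, 0, by simp⟩
  mul_mem' := by
    rintro X Y ⟨y₀, y₁, y₂, y₃, n, ⟨h0, h1, h2, h3, h4⟩, g0, g1, g2, g3, g4, g5⟩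
      ⟨z₀, z₁, z₂, z₃, m, ⟨k0, k1, k2, k3, k4⟩, l0, l1, l2, l3, l4, l5⟩
    refine ⟨y₀ + z₀, y₁ + z₁, y₂ + z₂, y₃ + z₃, n + m, ⟨?_, ?_, ?_, ?_, ?_⟩, ?_, ?_, ?_, ?_, ?_, ?_⟩
    · simp [h0, k0]; ring
    · simp [h1, k1]; ring
    · simp [h2, k2]; ring
    · simp [h3, k3]; ring
    · simp [h4, k4]; ring
    · simp [h1, k0]; linear_combination g0 + l0
    · simp [h2, k0]; linear_combination g1 + l1
    · simp [h3, k0]; linear_combination g2 + l2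
    · simp [h2, k1]; linear_combination g3 + l3
    · simp [h3, k1, k0]; linear_combination g4 + l4
    · simp [h3, k2]; linear_combination g5 + l5
  inv_mem' := by
    rintro X ⟨y₀, y₁, y₂, y₃, n, ⟨h0, h1, h2, h3, h4⟩, g0, g1, g2, g3, g4, g5⟩
    refine ⟨-y₀, -y₁, -y₂, -y₃, -n, ⟨?_, ?_, ?_, ?_, ?_⟩, ?_, ?_, ?_, ?_, ?_, ?_⟩
    · simp [h0]
    · simp [h1]
    · simp [h2]
    · simp [h3]
    · simp [h4]
    · simp [h1, h0]; linear_combination -g0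
    · simp [h2, h0]; linear_combination -g1
    · simp [h3, h0]; linear_combination -g2
    · simp [h2, h1]; linear_combination -g3
    · simp [h3, h1, h0]; linear_combination -g4
    · simp [h3, h2]; linear_combination -g5

lemma mem_relSubgroup {p : ℕ} {q : ℤ} {μ : Fin 6 → ℤ} {X : Word ε} :
    X ∈ relSubgroup p ε q μ ↔ ∃ y₀ y₁ y₂ y₃ n : ℤ,
    (X.xa = p * y₀ ∧ X.xb = p * y₁ ∧ X.xc = p * y₂ ∧ X.xd = p * y₃ ∧ X.xw = q * n) ∧
    (X.ab + y₁ + n * μ 0 : ZMod p) = 0 ∧ (X.ac + y₀ + y₁ + n * μ 1 : ZMod p) = 0 ∧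
    (X.ad + y₁ + n * μ 2 : ZMod p) = 0 ∧ (X.bc + y₂ + n * μ 3 : ZMod p) = 0 ∧
    (X.bd + y₂ + y₃ + n * μ 4 : ZMod p) = 0 ∧ (X.cd + n * μ 5 : ZMod p) = 0 := Iff.rfl

/-- The relators are central as soon as `w ^ q` acts trivially, that is, `p ∣ q * ε`. -/
instance relSubgroup_normal {p : ℕ} {q : ℤ} {μ : Fin 6 → ℤ} [hq : Fact ((q * ε : ZMod p) = 0)] :
    (relSubgroup p ε q μ).Normal where
  conj_mem := by
    rintro X ⟨y₀, y₁, y₂, y₃, n, ⟨h0, h1, h2, h3, h4⟩, g0, g1, g2, g3, g4, g5⟩ Y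
    refine ⟨y₀, y₁, y₂, y₃, n, ⟨?_, ?_, ?_, ?_, ?_⟩, ?_, ?_, ?_, ?_, ?_, ?_⟩
    · simp [h0]
    · simp [h1]
    · simp [h2]
    · simp [h3]
    · simp [h4]
    · simp [h1, h0]; linear_combination g0
    · simp [h2, h0]; linear_combination g1
    · simp [h3, h0]; linear_combination g2
    · simp [h2, h1]; linear_combination g3
    · simp [h3, h1, h0, h4]; linear_combination g4 - n * Y.xa * hq.out
    · simp [h3, h2]; linear_combination g5

end Word

/-- The group on `a, b, c, d, w` of class two with the power relations of `H`,
with `w ^ q = [a,b] ^ μ₀ ⋯ [c,d] ^ μ₅`, and with `w` centralizing `b, c, d`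
and `[w,a] = [b,d] ^ ε`. For `ε = 0`, `q = 1`, `μ = 0` this is `H`; for `ε = 1`, `q = p²` these are
the groups `G₂`. -/
abbrev Model (p : ℕ) (ε q : ℤ) (μ : Fin 6 → ℤ) : Type := Word ε ⧸ Word.relSubgroup p ε q μ

/-! ### Collection in groups of class two -/

section ClassTwo
variable {Γ : Type u} [Group Γ]

/-- `x ^ m * y ^ n = [x,y] ^ (m * n) * y ^ n * x ^ m` when `[x,y]` is central. -/
lemma zpow_mul_zpow_comm {x y : Γ} {t : Subgroup.center Γ} (h : ⁅x, y⁆ = t) (m n : ℤ) :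
    y ^ n * x ^ m = t ^ (-(m * n)) • (x ^ m * y ^ n) := by
  have h1 : x * y * x⁻¹ = t * y := by rw [← h, commutatorElement_def]; group
  have ht : ∀ g : Γ, Commute (t : Γ) g := fun g => (Subgroup.mem_center_iff.1 t.2 g).symm
  have h2 : x * y ^ n * x⁻¹ = t ^ n * y ^ n := by
    rw [← conj_zpow, h1, (ht y).mul_zpow]
  have h3 : (y ^ n)⁻¹ * x * y ^ n = t ^ n * x := by
    have : x * y ^ n = t ^ n * y ^ n * x := by rw [← h2]; group
    rw [mul_assoc, this, ((ht _).zpow_left n).eq, mul_assoc, inv_mul_cancel_left,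
      ((ht _).zpow_left n).eq]
  have h4 : (y ^ n)⁻¹ * x ^ m * y ^ n = t ^ (m * n) * x ^ m := by
    have := conj_zpow (i := m) (a := (y ^ n)⁻¹) (b := x)
    rw [inv_inv] at this
    rw [← this, h3, ((ht x).zpow_left n).mul_zpow, ← zpow_mul, mul_comm n m]
  rw [Subgroup.smul_def, smul_eq_mul, Subgroup.coe_zpow]
  have h5 : x ^ m * y ^ n = t ^ (m * n) * (y ^ n * x ^ m) := by
    rw [← mul_assoc, ((ht _).zpow_left _).eq, mul_assoc, ← h4]; group
  rw [h5, ← mul_assoc, ← zpow_add]; simp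

lemma zpow_mul_zpow_comm_assoc {x y : Γ} {t : Subgroup.center Γ} (h : ⁅x, y⁆ = t) (m n : ℤ)
    (g : Γ) : y ^ n * (x ^ m * g) = t ^ (-(m * n)) • (x ^ m * (y ^ n * g)) := by
  rw [← mul_assoc, zpow_mul_zpow_comm h, smul_mul_assoc, mul_assoc]

lemma commutator_pow_left {x y : Γ} (h : ⁅x, y⁆ ∈ Subgroup.center Γ) (n : ℕ) :
    ⁅x, y⁆ ^ n = ⁅x ^ n, y⁆ := by
  have h1 : x = ⁅x, y⁆ * (y * x * y⁻¹) := by rw [commutatorElement_def]; group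
  have h2 : x ^ n = ⁅x, y⁆ ^ n * (y * x ^ n * y⁻¹) := by
    conv_lhs => rw [h1]
    rw [Commute.mul_pow (Subgroup.mem_center_iff.1 h _).symm, conj_pow]
  rw [commutatorElement_def (x ^ n), eq_mul_inv_of_mul_eq h2.symm]
  group

lemma commutator_mul_center {x y s t : Γ} (hs : s ∈ Subgroup.center Γ)
    (ht : t ∈ Subgroup.center Γ) : ⁅x * s, y * t⁆ = ⁅x, y⁆ := by
  simp only [commutatorElement_def, mul_inv_rev]
  calc x * s * (y * t) * (s⁻¹ * x⁻¹) * (t⁻¹ * y⁻¹)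
      = x * (s * (y * t)) * s⁻¹ * x⁻¹ * t⁻¹ * y⁻¹ := by group
    _ = x * y * (t * x⁻¹) * t⁻¹ * y⁻¹ := by rw [← Subgroup.mem_center_iff.1 hs]; group
    _ = x * y * x⁻¹ * y⁻¹ := by rw [← Subgroup.mem_center_iff.1 ht]; group

end ClassTwo

/-- The commutator relations of the groups `Model p ε q μ`. -/
structure CommRel (ε : ℤ) {Γ : Type u} [Group Γ] (A B C D W : Γ) : Prop where
  ab : ⁅A, B⁆ ∈ Subgroup.center Γ
  ac : ⁅A, C⁆ ∈ Subgroup.center Γ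
  ad : ⁅A, D⁆ ∈ Subgroup.center Γ
  bc : ⁅B, C⁆ ∈ Subgroup.center Γ
  bd : ⁅B, D⁆ ∈ Subgroup.center Γ
  cd : ⁅C, D⁆ ∈ Subgroup.center Γ
  wa : ⁅W, A⁆ = ⁅B, D⁆ ^ ε
  wb : ⁅W, B⁆ = 1
  wc : ⁅W, C⁆ = 1
  wd : ⁅W, D⁆ = 1

/-- All the defining relations of the groups `Model p ε q μ`. -/
structure ModelRel (p : ℕ) (ε q : ℤ) (μ : Fin 6 → ℤ) {Γ : Type u} [Group Γ] (A B C D W : Γ) : Prop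
    extends CommRel ε A B C D W where
  pow_a : A ^ p = ⁅A, C⁆
  pow_b : B ^ p = ⁅A, B⁆ * ⁅A, C⁆ * ⁅A, D⁆
  pow_c : C ^ p = ⁅B, C⁆ * ⁅B, D⁆
  pow_d : D ^ p = ⁅B, D⁆
  pow_w : W ^ q = ⁅A, B⁆ ^ μ 0 * ⁅A, C⁆ ^ μ 1 * ⁅A, D⁆ ^ μ 2 * ⁅B, C⁆ ^ μ 3 * ⁅B, D⁆ ^ μ 4 *
    ⁅C, D⁆ ^ μ 5

section Lift
variable {Γ : Type u} [Group Γ] {A B C D W : Γ} {ε : ℤ}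

/-- Collected words in elements of a group. -/
def collect (A B C D W : Γ) (X : Word ε) : Γ :=
  A ^ X.xa * B ^ X.xb * C ^ X.xc * D ^ X.xd * W ^ X.xw *
    (⁅A, B⁆ ^ X.ab * ⁅A, C⁆ ^ X.ac * ⁅A, D⁆ ^ X.ad * ⁅B, C⁆ ^ X.bc * ⁅B, D⁆ ^ X.bd *
      ⁅C, D⁆ ^ X.cd)

lemma mul_center (g : Γ) (t : Subgroup.center Γ) : g * t = t • g := by
  rw [Subgroup.mem_center_iff.1 t.2 g]; rfl

open scoped IsMulCommutative in
/-- The homomorphism evaluating collected words as collected words. -/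
def collectHom (h : CommRel ε A B C D W) : Word ε →* Γ :=
  MonoidHom.mk' (collect A B C D W) (by
    obtain ⟨ab, hab⟩ : ∃ t : Subgroup.center Γ, ⁅A, B⁆ = t := ⟨⟨_, h.ab⟩, rfl⟩
    obtain ⟨ac, hac⟩ : ∃ t : Subgroup.center Γ, ⁅A, C⁆ = t := ⟨⟨_, h.ac⟩, rfl⟩
    obtain ⟨ad, had⟩ : ∃ t : Subgroup.center Γ, ⁅A, D⁆ = t := ⟨⟨_, h.ad⟩, rfl⟩
    obtain ⟨bc, hbc⟩ : ∃ t : Subgroup.center Γ, ⁅B, C⁆ = t := ⟨⟨_, h.bc⟩, rfl⟩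
    obtain ⟨bd, hbd⟩ : ∃ t : Subgroup.center Γ, ⁅B, D⁆ = t := ⟨⟨_, h.bd⟩, rfl⟩
    obtain ⟨cd, hcd⟩ : ∃ t : Subgroup.center Γ, ⁅C, D⁆ = t := ⟨⟨_, h.cd⟩, rfl⟩
    have haw : ⁅A, W⁆ = (bd ^ (-ε) : Subgroup.center Γ) := by
      rw [← commutatorElement_inv, h.wa, hbd, ← Subgroup.coe_zpow, ← Subgroup.coe_inv, zpow_neg]
    have hbw : ⁅B, W⁆ = (1 : Subgroup.center Γ) := by
      rw [← commutatorElement_inv, h.wb, inv_one]; rfl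
    have hcw : ⁅C, W⁆ = (1 : Subgroup.center Γ) := by
      rw [← commutatorElement_inv, h.wc, inv_one]; rfl
    have hdw : ⁅D, W⁆ = (1 : Subgroup.center Γ) := by
      rw [← commutatorElement_inv, h.wd, inv_one]; rfl
    intro X Y
    simp only [collect, hab, hac, had, hbc, hbd, hcd, ← Subgroup.coe_zpow,
      mul_center, mul_smul_comm, smul_mul_assoc, smul_smul]
    simp only [mul_assoc, mul_smul_comm, smul_smul,
      zpow_mul_zpow_comm_assoc hab, zpow_mul_zpow_comm_assoc hac, zpow_mul_zpow_comm_assoc had,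
      zpow_mul_zpow_comm_assoc hbc, zpow_mul_zpow_comm_assoc hbd, zpow_mul_zpow_comm_assoc hcd,
      zpow_mul_zpow_comm_assoc haw, zpow_mul_zpow_comm_assoc hbw, zpow_mul_zpow_comm_assoc hcw,
      zpow_mul_zpow_comm_assoc hdw]
    simp only [Word.mul_xa, Word.mul_xb, Word.mul_xc, Word.mul_xd, Word.mul_xw,
      zpow_add _ X.xa, zpow_add _ X.xb, zpow_add _ X.xc, zpow_add _ X.xd, zpow_add _ X.xw,
      mul_assoc]
    congr 1
    apply Additive.ofMul.injective
    simp only [ofMul_mul, ofMul_zpow, Word.mul_ab, Word.mul_ac, Word.mul_ad, Word.mul_bc,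
      Word.mul_bd, Word.mul_cd, ofMul_one]
    module)

lemma collectHom_apply (h : CommRel ε A B C D W) (X : Word ε) :
    collectHom h X = collect A B C D W X := rfl

lemma zpow_eq_one_of_intCast_eq_zero {g : Γ} {p : ℕ} (hg : g ^ p = 1) {n : ℤ}
    (hn : (n : ZMod p) = 0) : g ^ n = 1 := by
  obtain ⟨m, rfl⟩ := (ZMod.intCast_zmod_eq_zero_iff_dvd _ _).1 hn
  rw [zpow_mul, zpow_natCast, hg, one_zpow]

variable {p : ℕ} {q : ℤ} {μ : Fin 6 → ℤ}

open scoped IsMulCommutative in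
lemma relSubgroup_le_ker (h : ModelRel p ε q μ A B C D W) :
    Word.relSubgroup p ε q μ ≤ (collectHom h.toCommRel).ker := by
  rintro ⟨xa, xb, xc, xd, xw, uab, uac, uad, ubc, ubd, ucd⟩
    ⟨y₀, y₁, y₂, y₃, n, ⟨rfl, rfl, rfl, rfl, rfl⟩, g0, g1, g2, g3, g4, g5⟩
  have cent_one : ∀ {x y : Γ}, x ∈ Subgroup.center Γ → ⁅x, y⁆ = 1 := fun hx => by
    rw [commutatorElement_eq_one_iff_mul_comm, Subgroup.mem_center_iff.1 hx]
  have pa : A ^ p ∈ Subgroup.center Γ := h.pow_a ▸ h.ac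
  have pb : B ^ p ∈ Subgroup.center Γ := h.pow_b ▸ mul_mem (mul_mem h.ab h.ac) h.ad
  have pc : C ^ p ∈ Subgroup.center Γ := h.pow_c ▸ mul_mem h.bc h.bd
  have p1 : ⁅A, B⁆ ^ p = 1 := by rw [commutator_pow_left h.ab, cent_one pa]
  have p2 : ⁅A, C⁆ ^ p = 1 := by rw [commutator_pow_left h.ac, cent_one pa]
  have p3 : ⁅A, D⁆ ^ p = 1 := by rw [commutator_pow_left h.ad, cent_one pa]
  have p4 : ⁅B, C⁆ ^ p = 1 := by rw [commutator_pow_left h.bc, cent_one pb]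
  have p5 : ⁅B, D⁆ ^ p = 1 := by rw [commutator_pow_left h.bd, cent_one pb]
  have p6 : ⁅C, D⁆ ^ p = 1 := by rw [commutator_pow_left h.cd, cent_one pc]
  rw [MonoidHom.mem_ker, collectHom_apply, collect]
  simp only [zpow_mul, zpow_natCast, h.pow_a, h.pow_b, h.pow_c, h.pow_d, h.pow_w]
  simp only [← Int.cast_add, ← Int.cast_mul] at g0 g1 g2 g3 g4 g5
  replace g0 := zpow_eq_one_of_intCast_eq_zero p1 g0
  replace g1 := zpow_eq_one_of_intCast_eq_zero p2 g1
  replace g2 := zpow_eq_one_of_intCast_eq_zero p3 g2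
  replace g3 := zpow_eq_one_of_intCast_eq_zero p4 g3
  replace g4 := zpow_eq_one_of_intCast_eq_zero p5 g4
  replace g5 := zpow_eq_one_of_intCast_eq_zero p6 g5
  obtain ⟨ab, hab⟩ : ∃ t : Subgroup.center Γ, ⁅A, B⁆ = t := ⟨⟨_, h.ab⟩, rfl⟩
  obtain ⟨ac, hac⟩ : ∃ t : Subgroup.center Γ, ⁅A, C⁆ = t := ⟨⟨_, h.ac⟩, rfl⟩
  obtain ⟨ad, had⟩ : ∃ t : Subgroup.center Γ, ⁅A, D⁆ = t := ⟨⟨_, h.ad⟩, rfl⟩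
  obtain ⟨bc, hbc⟩ : ∃ t : Subgroup.center Γ, ⁅B, C⁆ = t := ⟨⟨_, h.bc⟩, rfl⟩
  obtain ⟨bd, hbd⟩ : ∃ t : Subgroup.center Γ, ⁅B, D⁆ = t := ⟨⟨_, h.bd⟩, rfl⟩
  obtain ⟨cd, hcd⟩ : ∃ t : Subgroup.center Γ, ⁅C, D⁆ = t := ⟨⟨_, h.cd⟩, rfl⟩
  simp only [hab, hac, had, hbc, hbd, hcd] at g0 g1 g2 g3 g4 g5 ⊢
  norm_cast at g0 g1 g2 g3 g4 g5 ⊢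
  apply Additive.ofMul.injective
  apply_fun Additive.ofMul at g0 g1 g2 g3 g4 g5
  simp only [ofMul_mul, ofMul_zpow, ofMul_one] at *
  linear_combination (norm := module) g0 + g1 + g2 + g3 + g4 + g5

/-- The universal property of the groups `Model p ε q μ`. -/
def Model.lift (h : ModelRel p ε q μ A B C D W) [(Word.relSubgroup p ε q μ).Normal] :
    Model p ε q μ →* Γ :=
  QuotientGroup.lift _ (collectHom h.toCommRel) (relSubgroup_le_ker h)

end Lift

/-! ### Presentations of the model groups and of `H` -/

lemma zpow_of_map_add {Γ : Type u} [Group Γ] (k : ℤ → Γ) (hk : ∀ m n, k (m + n) = k m * k n)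
    (n : ℤ) : k 1 ^ n = k n := by
  have := map_zpow (MonoidHom.mk' (fun m : Multiplicative ℤ => k m.toAdd) fun m n => hk _ _)
    (Multiplicative.ofAdd 1) n
  simpa [← ofAdd_zsmul] using this.symm

namespace Word

variable {ε : ℤ}

/-- The word `a`. -/
def genA : Word ε := ⟨1, 0, 0, 0, 0, 0, 0, 0, 0, 0, 0⟩
/-- The word `b`. -/
def genB : Word ε := ⟨0, 1, 0, 0, 0, 0, 0, 0, 0, 0, 0⟩
/-- The word `c`. -/
def genC : Word ε := ⟨0, 0, 1, 0, 0, 0, 0, 0, 0, 0, 0⟩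
/-- The word `d`. -/
def genD : Word ε := ⟨0, 0, 0, 1, 0, 0, 0, 0, 0, 0, 0⟩
/-- The word `w`. -/
def genW : Word ε := ⟨0, 0, 0, 0, 1, 0, 0, 0, 0, 0, 0⟩

lemma genA_zpow (n : ℤ) : (genA : Word ε) ^ n = ⟨n, 0, 0, 0, 0, 0, 0, 0, 0, 0, 0⟩ :=
  zpow_of_map_add (fun n => (⟨n, 0, 0, 0, 0, 0, 0, 0, 0, 0, 0⟩ : Word ε))
    (fun m n => by ext <;> simp) n
lemma genB_zpow (n : ℤ) : (genB : Word ε) ^ n = ⟨0, n, 0, 0, 0, 0, 0, 0, 0, 0, 0⟩ :=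
  zpow_of_map_add (fun n => (⟨0, n, 0, 0, 0, 0, 0, 0, 0, 0, 0⟩ : Word ε))
    (fun m n => by ext <;> simp) n
lemma genC_zpow (n : ℤ) : (genC : Word ε) ^ n = ⟨0, 0, n, 0, 0, 0, 0, 0, 0, 0, 0⟩ :=
  zpow_of_map_add (fun n => (⟨0, 0, n, 0, 0, 0, 0, 0, 0, 0, 0⟩ : Word ε))
    (fun m n => by ext <;> simp) n
lemma genD_zpow (n : ℤ) : (genD : Word ε) ^ n = ⟨0, 0, 0, n, 0, 0, 0, 0, 0, 0, 0⟩ :=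
  zpow_of_map_add (fun n => (⟨0, 0, 0, n, 0, 0, 0, 0, 0, 0, 0⟩ : Word ε))
    (fun m n => by ext <;> simp) n
lemma genW_zpow (n : ℤ) : (genW : Word ε) ^ n = ⟨0, 0, 0, 0, n, 0, 0, 0, 0, 0, 0⟩ :=
  zpow_of_map_add (fun n => (⟨0, 0, 0, 0, n, 0, 0, 0, 0, 0, 0⟩ : Word ε))
    (fun m n => by ext <;> simp) n

lemma ofComm_zpow (u : Fin 6 → ℤ) (n : ℤ) : (ofComm u : Word ε) ^ n = ofComm (n • u) := by
  have := zpow_of_map_add (fun n => (ofComm (n • u) : Word ε))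
    (fun m n => by ext <;> simp [ofComm] <;> ring) n
  simpa using this

lemma comm_ab : ⁅(genA : Word ε), (genB : Word ε)⁆ = ofComm ![1, 0, 0, 0, 0, 0] := by
  rw [commutator_eq]; ext <;> simp [genA, genB, ofComm]
lemma comm_ac : ⁅(genA : Word ε), (genC : Word ε)⁆ = ofComm ![0, 1, 0, 0, 0, 0] := by
  rw [commutator_eq]; ext <;> simp [genA, genC, ofComm]
lemma comm_ad : ⁅(genA : Word ε), (genD : Word ε)⁆ = ofComm ![0, 0, 1, 0, 0, 0] := by
  rw [commutator_eq]; ext <;> simp [genA, genD, ofComm]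
lemma comm_bc : ⁅(genB : Word ε), (genC : Word ε)⁆ = ofComm ![0, 0, 0, 1, 0, 0] := by
  rw [commutator_eq]; ext <;> simp [genB, genC, ofComm]
lemma comm_bd : ⁅(genB : Word ε), (genD : Word ε)⁆ = ofComm ![0, 0, 0, 0, 1, 0] := by
  rw [commutator_eq]; ext <;> simp [genB, genD, ofComm]
lemma comm_cd : ⁅(genC : Word ε), (genD : Word ε)⁆ = ofComm ![0, 0, 0, 0, 0, 1] := by
  rw [commutator_eq]; ext <;> simp [genC, genD, ofComm]

lemma ofComm_mem_center (u : Fin 6 → ℤ) : ofComm u ∈ Subgroup.center (Word ε) := by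
  rw [Subgroup.mem_center_iff]
  intro X
  ext <;> simp [ofComm, add_comm]

/-- Every word is the collected word that it encodes. -/
lemma collect_gen (X : Word ε) : collect genA genB genC genD genW X = X := by
  simp only [collect, genA_zpow, genB_zpow, genC_zpow, genD_zpow, genW_zpow, comm_ab, comm_ac,
    comm_ad, comm_bc, comm_bd, comm_cd, ofComm_zpow]
  ext <;> simp [ofComm]

end Word

section Maps
variable {Γ : Type u} [Group Γ] {Δ : Type*} [Group Δ] {A B C D W : Γ} {ε : ℤ}

lemma map_collect (f : Γ →* Δ) (X : Word ε) :
    f (collect A B C D W X) = collect (f A) (f B) (f C) (f D) (f W) X := by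
  simp only [collect, map_mul, map_zpow, map_commutatorElement]

end Maps

namespace Model
open Word

variable {p : ℕ} {ε q : ℤ} {μ : Fin 6 → ℤ} [Fact ((q * ε : ZMod p) = 0)]

/-- The element of the model group given by a collected word. -/
abbrev mk : Word ε →* Model p ε q μ := QuotientGroup.mk' _

lemma mk_surjective : Function.Surjective (mk : Word ε →* Model p ε q μ) :=
  QuotientGroup.mk'_surjective _

lemma mk_eq_one_iff {X : Word ε} : (mk X : Model p ε q μ) = 1 ↔ X ∈ relSubgroup p ε q μ :=
  QuotientGroup.eq_one_iff X

lemma mk_eq_mk_iff {X Y : Word ε} :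
    (mk X : Model p ε q μ) = mk Y ↔ X⁻¹ * Y ∈ relSubgroup p ε q μ :=
  QuotientGroup.eq

lemma mk_ofComm_mem_center (u : Fin 6 → ℤ) :
    (mk (ofComm u) : Model p ε q μ) ∈ Subgroup.center (Model p ε q μ) := by
  rw [Subgroup.mem_center_iff]
  intro X
  obtain ⟨X, rfl⟩ := mk_surjective X
  rw [← map_mul, Subgroup.mem_center_iff.1 (ofComm_mem_center u), map_mul]

lemma commutator_mk (X Y : Word ε) : ∃ u : Fin 6 → ℤ,
    ⁅(mk X : Model p ε q μ), (mk Y : Model p ε q μ)⁆ = mk (ofComm u) := by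
  rw [← map_commutatorElement, commutator_eq]
  exact ⟨![_, _, _, _, _, _], rfl⟩

lemma commutator_mem_center (x y : Model p ε q μ) : ⁅x, y⁆ ∈ Subgroup.center _ := by
  obtain ⟨X, rfl⟩ := mk_surjective x
  obtain ⟨Y, rfl⟩ := mk_surjective y
  obtain ⟨u, hu⟩ := commutator_mk (p := p) (q := q) (μ := μ) X Y
  rw [hu]
  exact mk_ofComm_mem_center u

variable (p ε q μ) in
lemma modelRel : ModelRel p ε q μ (mk genA : Model p ε q μ) (mk genB) (mk genC) (mk genD)
    (mk genW) where
  ab := commutator_mem_center _ _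
  ac := commutator_mem_center _ _
  ad := commutator_mem_center _ _
  bc := commutator_mem_center _ _
  bd := commutator_mem_center _ _
  cd := commutator_mem_center _ _
  wa := by
    simp only [← map_commutatorElement, comm_bd, ofComm_zpow, ← map_zpow]
    congr 1
    rw [commutator_eq]; ext <;> simp [genA, genW, ofComm]
  wb := by
    rw [← map_commutatorElement, ← map_one mk]; congr 1
    rw [commutator_eq]; ext <;> simp [genB, genW]
  wc := by
    rw [← map_commutatorElement, ← map_one mk]; congr 1
    rw [commutator_eq]; ext <;> simp [genC, genW]
  wd := by
    rw [← map_commutatorElement, ← map_one mk]; congr 1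
    rw [commutator_eq]; ext <;> simp [genD, genW]
  pow_a := by
    simp only [← map_commutatorElement, ← zpow_natCast, ← map_zpow, comm_ac, genA_zpow]
    rw [mk_eq_mk_iff, mem_relSubgroup]
    exact ⟨-1, 0, 0, 0, 0, by simp [ofComm]⟩
  pow_b := by
    simp only [← map_commutatorElement, ← zpow_natCast, ← map_zpow, ← map_mul, comm_ab, comm_ac,
      comm_ad, genB_zpow]
    rw [mk_eq_mk_iff, mem_relSubgroup]
    exact ⟨0, -1, 0, 0, 0, by simp [ofComm]⟩
  pow_c := by
    simp only [← map_commutatorElement, ← zpow_natCast, ← map_zpow, ← map_mul, comm_bc, comm_bd,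
      genC_zpow]
    rw [mk_eq_mk_iff, mem_relSubgroup]
    exact ⟨0, 0, -1, 0, 0, by simp [ofComm]⟩
  pow_d := by
    simp only [← map_commutatorElement, ← zpow_natCast, ← map_zpow, comm_bd, genD_zpow]
    rw [mk_eq_mk_iff, mem_relSubgroup]
    exact ⟨0, 0, 0, -1, 0, by simp [ofComm]⟩
  pow_w := by
    simp only [← map_commutatorElement, ← map_zpow, ← map_mul, comm_ab, comm_ac, comm_ad, comm_bc,
      comm_bd, comm_cd, genW_zpow, ofComm_zpow]
    rw [mk_eq_mk_iff, mem_relSubgroup]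
    exact ⟨0, 0, 0, 0, -1, by simp [ofComm]⟩

lemma mk_eq_collect (X : Word ε) : (mk X : Model p ε q μ) =
    collect (mk genA) (mk genB) (mk genC) (mk genD) (mk genW) X := by
  rw [← map_collect, collect_gen]

lemma lift_mk {Γ : Type u} [Group Γ] {A B C D W : Γ} (h : ModelRel p ε q μ A B C D W)
    (X : Word ε) : lift h (mk X) = collect A B C D W X := rfl

lemma hom_ext {Γ : Type u} [Group Γ] {f g : Model p ε q μ →* Γ}
    (ha : f (mk genA) = g (mk genA)) (hb : f (mk genB) = g (mk genB))
    (hc : f (mk genC) = g (mk genC)) (hd : f (mk genD) = g (mk genD))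
    (hw : f (mk genW) = g (mk genW)) : f = g := by
  refine MonoidHom.ext fun x => ?_
  obtain ⟨X, rfl⟩ := mk_surjective x
  rw [mk_eq_collect, map_collect, map_collect, ha, hb, hc, hd, hw]

end Model

section Collect
variable {Γ : Type u} [Group Γ] {A B C D W : Γ} {ε : ℤ}

lemma collect_genA : collect A B C D W (Word.genA : Word ε) = A := by simp [collect, Word.genA]
lemma collect_genB : collect A B C D W (Word.genB : Word ε) = B := by simp [collect, Word.genB]
lemma collect_genC : collect A B C D W (Word.genC : Word ε) = C := by simp [collect, Word.genC]
lemma collect_genD : collect A B C D W (Word.genD : Word ε) = D := by simp [collect, Word.genD]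
lemma collect_genW : collect A B C D W (Word.genW : Word ε) = W := by simp [collect, Word.genW]

end Collect

section H
variable (p : ℕ)

lemma H_commutator_mem_center (x y : H p) : ⁅x, y⁆ ∈ Subgroup.center (H p) := by
  rw [Subgroup.mem_center_iff]
  intro z
  obtain ⟨x, rfl⟩ := PresentedGroup.mk_surjective _ x
  obtain ⟨y, rfl⟩ := PresentedGroup.mk_surjective _ y
  obtain ⟨z, rfl⟩ := PresentedGroup.mk_surjective _ z
  have : PresentedGroup.mk (relators p) ⁅⁅x, y⁆, z⁆ = 1 :=
    PresentedGroup.one_of_mem (Or.inl ⟨x, y, z, rfl⟩)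
  rw [map_commutatorElement, map_commutatorElement, commutatorElement_eq_one_iff_mul_comm] at this
  exact this.symm

lemma H_pow_a : a p ^ p = ⁅a p, c p⁆ := by
  have : PresentedGroup.mk (relators p) _ = 1 := PresentedGroup.one_of_mem (Or.inr (Or.inl rfl))
  rw [map_mul, map_inv, mul_inv_eq_one, map_pow, map_commutatorElement] at this
  exact this

lemma H_pow_b : b p ^ p = ⁅a p, b p * c p * d p⁆ := by
  have : PresentedGroup.mk (relators p) _ = 1 :=
    PresentedGroup.one_of_mem (Or.inr (Or.inr (Or.inl rfl)))
  rw [map_mul, map_inv, mul_inv_eq_one, map_pow, map_commutatorElement, map_mul, map_mul] at this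
  exact this

lemma H_pow_c : c p ^ p = ⁅b p, c p * d p⁆ := by
  have : PresentedGroup.mk (relators p) _ = 1 :=
    PresentedGroup.one_of_mem (Or.inr (Or.inr (Or.inr (Or.inl rfl))))
  rw [map_mul, map_inv, mul_inv_eq_one, map_pow, map_commutatorElement, map_mul] at this
  exact this

lemma H_pow_d : d p ^ p = ⁅b p, d p⁆ := by
  have : PresentedGroup.mk (relators p) _ = 1 :=
    PresentedGroup.one_of_mem (Or.inr (Or.inr (Or.inr (Or.inr rfl))))
  rw [map_mul, map_inv, mul_inv_eq_one, map_pow, map_commutatorElement] at this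
  exact this

lemma commutator_mul_right_of_mem_center {Γ : Type u} [Group Γ] {x y z : Γ}
    (h : ⁅x, z⁆ ∈ Subgroup.center Γ) : ⁅x, y * z⁆ = ⁅x, y⁆ * ⁅x, z⁆ := by
  rw [commutatorElement_mul_right_eq_mul_conj, mul_assoc, mul_assoc,
    ← Subgroup.mem_center_iff.1 h]
  group

lemma H_modelRel : ModelRel p 0 1 0 (a p) (b p) (c p) (d p) 1 where
  ab := H_commutator_mem_center p _ _
  ac := H_commutator_mem_center p _ _
  ad := H_commutator_mem_center p _ _
  bc := H_commutator_mem_center p _ _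
  bd := H_commutator_mem_center p _ _
  cd := H_commutator_mem_center p _ _
  wa := by simp
  wb := by simp
  wc := by simp
  wd := by simp
  pow_a := H_pow_a p
  pow_b := by
    rw [H_pow_b, commutator_mul_right_of_mem_center (H_commutator_mem_center p _ _),
      commutator_mul_right_of_mem_center (H_commutator_mem_center p _ _)]
  pow_c := by rw [H_pow_c, commutator_mul_right_of_mem_center (H_commutator_mem_center p _ _)]
  pow_d := H_pow_d p
  pow_w := by simp

/-- Homomorphisms out of `H` into a group of class two in which the power relations hold. -/
lemma exists_H_hom {Γ : Type u} [Group Γ] (hΓ : ∀ x y : Γ, ⁅x, y⁆ ∈ Subgroup.center Γ)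
    {A B C D : Γ} (hA : A ^ p = ⁅A, C⁆) (hB : B ^ p = ⁅A, B⁆ * ⁅A, C⁆ * ⁅A, D⁆)
    (hC : C ^ p = ⁅B, C⁆ * ⁅B, D⁆) (hD : D ^ p = ⁅B, D⁆) :
    ∃ f : H p →* Γ, f (a p) = A ∧ f (b p) = B ∧ f (c p) = C ∧ f (d p) = D := by
  have key : ∀ r ∈ relators p, FreeGroup.lift ![A, B, C, D] r = 1 := by
    rintro r (⟨x, y, z, rfl⟩ | rfl | rfl | rfl | rfl)
    · rw [map_commutatorElement, commutatorElement_eq_one_iff_mul_comm, map_commutatorElement,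
        Subgroup.mem_center_iff.1 (hΓ _ _)]
    · rw [map_mul, map_inv, mul_inv_eq_one]
      simp [map_commutatorElement, hA]
    · rw [map_mul, map_inv, mul_inv_eq_one]
      simp only [map_mul, map_pow, map_commutatorElement, FreeGroup.lift_apply_of]
      rw [commutator_mul_right_of_mem_center (hΓ _ _), commutator_mul_right_of_mem_center (hΓ _ _)]
      simp [hB]
    · rw [map_mul, map_inv, mul_inv_eq_one]
      simp only [map_mul, map_pow, map_commutatorElement, FreeGroup.lift_apply_of]
      rw [commutator_mul_right_of_mem_center (hΓ _ _)]
      simp [hC]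
    · rw [map_mul, map_inv, mul_inv_eq_one]
      simp [map_commutatorElement, hD]
  exact ⟨PresentedGroup.toGroup key, PresentedGroup.toGroup.of key, PresentedGroup.toGroup.of key,
    PresentedGroup.toGroup.of key, PresentedGroup.toGroup.of key⟩

lemma H_hom_ext {p} {Γ : Type u} [Group Γ] {f g : H p →* Γ} (ha : f (a p) = g (a p))
    (hb : f (b p) = g (b p)) (hc : f (c p) = g (c p)) (hd : f (d p) = g (d p)) : f = g := by
  apply PresentedGroup.ext
  intro i
  fin_cases i
  exacts [ha, hb, hc, hd]

end H

/-! ### Normal forms in `H` and the prescribed automorphism -/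

namespace Word
variable {ε : ℤ}

/-- The commutator form on exponent vectors, in the coordinates `ab, ac, ad, bc, bd, cd`. -/
def wedge (X Y : Word ε) : Fin 6 → ℤ :=
  ![X.xa * Y.xb - X.xb * Y.xa, X.xa * Y.xc - X.xc * Y.xa, X.xa * Y.xd - X.xd * Y.xa,
    X.xb * Y.xc - X.xc * Y.xb,
    X.xb * Y.xd - X.xd * Y.xb + ε * (X.xw * Y.xa - X.xa * Y.xw), X.xc * Y.xd - X.xd * Y.xc]

lemma commutator_eq_ofComm (X Y : Word ε) : ⁅X, Y⁆ = ofComm (wedge X Y) := commutator_eq X Y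

/-- The `p`-th power map on the exponents of `a, b, c, d`, in the coordinates
`ab, ac, ad, bc, bd, cd`. -/
def powVec (X : Word ε) : Fin 6 → ℤ := ![X.xb, X.xa + X.xb, X.xb, X.xc, X.xc + X.xd, 0]

lemma ofComm_add (u v : Fin 6 → ℤ) : (ofComm (u + v) : Word ε) = ofComm u * ofComm v := by
  ext <;> simp [ofComm]

lemma ofComm_neg (u : Fin 6 → ℤ) : (ofComm (-u) : Word ε) = (ofComm u)⁻¹ := by
  ext <;> simp [ofComm]

/-- The central words `ofComm u` as a homomorphism. -/
def ofCommHom (ε : ℤ) : Multiplicative (Fin 6 → ℤ) →* Word ε :=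
  MonoidHom.mk' (fun u => ofComm u.toAdd) fun _ _ => ofComm_add _ _

/-- The word with the powers of `w` left out. -/
def dropW {δ : ℤ} (X : Word δ) : Word ε :=
  ⟨X.xa, X.xb, X.xc, X.xd, 0, X.ab, X.ac, X.ad, X.bc, X.bd, X.cd⟩

end Word

lemma collect_dropW {Γ : Type u} [Group Γ] {A B C D W : Γ} {ε δ : ℤ} (X : Word δ) :
    collect A B C D W (X.dropW : Word ε) = collect A B C D 1 X := by
  simp [collect, Word.dropW]

lemma choose_two_cast_eq_zero {p : ℕ} (hp : p.Prime) (hodd : p ≠ 2) :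
    ((p.choose 2 : ℕ) : ZMod p) = 0 :=
  (ZMod.natCast_eq_zero_iff _ _).2
    (hp.dvd_choose_self two_ne_zero (lt_of_le_of_ne hp.two_le hodd.symm))

namespace Model
open Word

variable {p : ℕ} {ε q : ℤ} {μ : Fin 6 → ℤ} [Fact ((q * ε : ZMod p) = 0)]

lemma commutator_mk_mk (X Y : Word ε) :
    ⁅(mk X : Model p ε q μ), (mk Y : Model p ε q μ)⁆ = mk (ofComm (wedge X Y)) := by
  rw [← map_commutatorElement, commutator_eq_ofComm]

lemma mk_ofComm_eq_one_iff (hp : p ≠ 0) (hq : q ≠ 0) {u : Fin 6 → ℤ} :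
    (mk (ofComm u) : Model p ε q μ) = 1 ↔ ∀ i, (u i : ZMod p) = 0 := by
  rw [mk_eq_one_iff, mem_relSubgroup]
  have hp' : (p : ℤ) ≠ 0 := by exact_mod_cast hp
  constructor
  · rintro ⟨y₀, y₁, y₂, y₃, n, ⟨h0, h1, h2, h3, h4⟩, g0, g1, g2, g3, g4, g5⟩
    have e0 : y₀ = 0 := (mul_eq_zero.1 h0.symm).resolve_left hp'
    have e1 : y₁ = 0 := (mul_eq_zero.1 h1.symm).resolve_left hp'
    have e2 : y₂ = 0 := (mul_eq_zero.1 h2.symm).resolve_left hp'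
    have e3 : y₃ = 0 := (mul_eq_zero.1 h3.symm).resolve_left hp'
    have e4 : n = 0 := (mul_eq_zero.1 h4.symm).resolve_left hq
    subst e0 e1 e2 e3 e4
    simp [ofComm] at g0 g1 g2 g3 g4 g5
    intro i
    fin_cases i <;> assumption
  · intro h
    exact ⟨0, 0, 0, 0, 0, by simp [ofComm, h]⟩

lemma mk_ofComm_eq_iff (hp : p ≠ 0) (hq : q ≠ 0) {u v : Fin 6 → ℤ} :
    (mk (ofComm u) : Model p ε q μ) = mk (ofComm v) ↔ ∀ i, (u i : ZMod p) = v i := by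
  rw [← mul_inv_eq_one, ← map_inv, ← map_mul, ← ofComm_neg, ← ofComm_add,
    mk_ofComm_eq_one_iff hp hq]
  simp [← sub_eq_add_neg, sub_eq_zero]

lemma mk_pow (hp : p.Prime) (hodd : p ≠ 2) (X : Word ε) :
    (mk X : Model p ε q μ) ^ p = mk (ofComm (powVec X)) * mk (genW ^ (p * X.xw)) := by
  rw [← map_pow, ← map_mul, mk_eq_mk_iff, mem_relSubgroup, pow_eq, genW_zpow]
  have h2 := choose_two_cast_eq_zero hp hodd
  exact ⟨-X.xa, -X.xb, -X.xc, -X.xd, 0, by simp [ofComm, powVec, h2]⟩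

lemma mk_zpow_genW_mul {n : ℤ} :
    (mk (genW ^ (q * n)) : Model p ε q μ) = mk (ofComm (n • μ)) := by
  rw [mk_eq_mk_iff, mem_relSubgroup, genW_zpow]
  exact ⟨0, 0, 0, 0, -n, by simp [ofComm]⟩

/-- The consequences of a relation `x ^ p = z` with `z` a product of commutators. -/
lemma pow_eq_mk_ofComm (hp : p.Prime) (hodd : p ≠ 2) (hq : q ≠ 0) {X : Word ε} {v : Fin 6 → ℤ}
    (h : (mk X : Model p ε q μ) ^ p = mk (ofComm v)) :
    ∃ n : ℤ, p * X.xw = q * n ∧ ∀ i, (powVec X i + n * μ i : ZMod p) = v i := by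
  rw [mk_pow hp hodd] at h
  have hw : ∃ n : ℤ, p * X.xw = q * n := by
    rw [← map_mul, mk_eq_mk_iff, mem_relSubgroup, genW_zpow] at h
    obtain ⟨-, -, -, -, n, ⟨-, -, -, -, h4⟩, -⟩ := h
    simp [ofComm] at h4
    exact ⟨-n, by linear_combination -h4⟩
  obtain ⟨n, hn⟩ := hw
  refine ⟨n, hn, ?_⟩
  rw [hn, mk_zpow_genW_mul, ← map_mul, ← ofComm_add, mk_ofComm_eq_iff hp.ne_zero hq] at h
  simpa using h

variable (p ε q μ) in
lemma commutator_le_range :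
    commutator (Model p ε q μ) ≤ (mk.comp (ofCommHom ε) : _ →* Model p ε q μ).range := by
  rw [commutator_def, Subgroup.commutator_le]
  intro x _ y _
  obtain ⟨X, rfl⟩ := mk_surjective x
  obtain ⟨Y, rfl⟩ := mk_surjective y
  exact ⟨Multiplicative.ofAdd (wedge X Y), (commutator_mk_mk X Y).symm⟩

end Model

section H
open Word
variable (p : ℕ)

/-- The collected word in the generators of `H`; the letter `w` is sent to `1`. -/
abbrev HWord : Word 0 →* H p := collectHom (H_modelRel p).toCommRel

/-- The normality condition of `relSubgroup_normal` for the model of `H`. -/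
instance : Fact (((1 : ℤ) * (0 : ℤ) : ZMod p) = 0) := ⟨by simp⟩

/-- The normality condition of `relSubgroup_normal` for the models of the groups `G₂`. -/
instance : Fact ((((p ^ 2 : ℕ) : ℤ) * (1 : ℤ) : ZMod p) = 0) := ⟨by simp⟩

lemma exists_H_toModel (ε q : ℤ) (μ : Fin 6 → ℤ) [Fact ((q * ε : ZMod p) = 0)] :
    ∃ f : H p →* Model p ε q μ, f (a p) = Model.mk genA ∧ f (b p) = Model.mk genB ∧
      f (c p) = Model.mk genC ∧ f (d p) = Model.mk genD :=
  exists_H_hom p Model.commutator_mem_center (Model.modelRel p ε q μ).pow_a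
    (Model.modelRel p ε q μ).pow_b (Model.modelRel p ε q μ).pow_c (Model.modelRel p ε q μ).pow_d

/-- The homomorphism from `H` to a model group sending generators to generators. -/
noncomputable def H_toModel (ε q : ℤ) (μ : Fin 6 → ℤ) [Fact ((q * ε : ZMod p) = 0)] :
    H p →* Model p ε q μ :=
  (exists_H_toModel p ε q μ).choose

section
variable (ε q : ℤ) (μ : Fin 6 → ℤ) [Fact ((q * ε : ZMod p) = 0)]

lemma H_toModel_a : H_toModel p ε q μ (a p) = Model.mk genA :=
  (exists_H_toModel p ε q μ).choose_spec.1
lemma H_toModel_b : H_toModel p ε q μ (b p) = Model.mk genB :=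
  (exists_H_toModel p ε q μ).choose_spec.2.1
lemma H_toModel_c : H_toModel p ε q μ (c p) = Model.mk genC :=
  (exists_H_toModel p ε q μ).choose_spec.2.2.1
lemma H_toModel_d : H_toModel p ε q μ (d p) = Model.mk genD :=
  (exists_H_toModel p ε q μ).choose_spec.2.2.2

lemma H_toModel_HWord (X : Word 0) : H_toModel p ε q μ (HWord p X) = Model.mk X.dropW := by
  rw [collectHom_apply, map_collect, H_toModel_a, H_toModel_b, H_toModel_c, H_toModel_d, map_one,
    Model.mk_eq_collect X.dropW, collect_dropW]

lemma H_toModel_HWord_ofComm (u : Fin 6 → ℤ) :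
    H_toModel p ε q μ (HWord p (ofComm u)) = Model.mk (ofComm u) :=
  H_toModel_HWord p ε q μ _

end

lemma HWord_surjective : Function.Surjective (HWord p) := by
  intro h
  have : (Model.lift (H_modelRel p)).comp (H_toModel p 0 1 0) = MonoidHom.id _ := by
    apply H_hom_ext <;>
      simp only [MonoidHom.comp_apply, H_toModel_a, H_toModel_b, H_toModel_c, H_toModel_d,
        Model.lift_mk, collect_genA, collect_genB, collect_genC, collect_genD, MonoidHom.id_apply]
  obtain ⟨X, hX⟩ := Model.mk_surjective (H_toModel p 0 1 0 h)
  refine ⟨X, ?_⟩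
  have h2 := DFunLike.congr_fun this h
  rw [MonoidHom.comp_apply, ← hX] at h2
  exact h2

lemma HWord_eq_one_of_mem {X : Word 0} (hX : X ∈ relSubgroup p 0 1 0) : HWord p X = 1 :=
  relSubgroup_le_ker (H_modelRel p) hX

/-- Words trivial in `H` are those of `relSubgroup p 0 1 0`: the relations of `H` have no further
consequences. -/
lemma mem_of_HWord_eq_one {X : Word 0} (h : HWord p X = 1) : X ∈ relSubgroup p 0 1 0 := by
  have h2 : (Model.mk X.dropW : Model p 0 1 0) = 1 := by rw [← H_toModel_HWord, h, map_one]
  obtain ⟨y₀, y₁, y₂, y₃, n, ⟨h0, h1, h2, h3, h4⟩, g0, g1, g2, g3, g4, g5⟩ :=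
    mem_relSubgroup.1 (Model.mk_eq_one_iff.1 h2)
  refine ⟨y₀, y₁, y₂, y₃, X.xw, ⟨h0, h1, h2, h3, by simp⟩, ?_, ?_, ?_, ?_, ?_, ?_⟩
  · simpa [dropW] using g0
  · simpa [dropW] using g1
  · simpa [dropW] using g2
  · simpa [dropW] using g3
  · simpa [dropW] using g4
  · simpa [dropW] using g5

lemma H_toModel_injective (ε q : ℤ) (μ : Fin 6 → ℤ) [Fact ((q * ε : ZMod p) = 0)] (hq : q ≠ 0) :
    Function.Injective (H_toModel p ε q μ) := by
  rw [injective_iff_map_eq_one]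
  intro h hh
  obtain ⟨X, rfl⟩ := HWord_surjective p h
  rw [H_toModel_HWord] at hh
  obtain ⟨y₀, y₁, y₂, y₃, n, ⟨h0, h1, h2, h3, h4⟩, g0, g1, g2, g3, g4, g5⟩ :=
    mem_relSubgroup.1 (Model.mk_eq_one_iff.1 hh)
  obtain rfl : n = 0 := (mul_eq_zero.1 h4.symm).resolve_left hq
  apply HWord_eq_one_of_mem
  refine ⟨y₀, y₁, y₂, y₃, X.xw, ⟨h0, h1, h2, h3, by simp⟩, ?_, ?_, ?_, ?_, ?_, ?_⟩
  · simpa [dropW] using g0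
  · simpa [dropW] using g1
  · simpa [dropW] using g2
  · simpa [dropW] using g3
  · simpa [dropW] using g4
  · simpa [dropW] using g5

lemma exists_ofComm_of_mem_commutator {m : H p} (hm : m ∈ commutator (H p)) :
    ∃ u : Fin 6 → ℤ, HWord p (ofComm u) = m := by
  have : commutator (H p) ≤ ((HWord p).comp (ofCommHom 0)).range := by
    rw [commutator_def, Subgroup.commutator_le]
    intro x _ y _
    obtain ⟨X, rfl⟩ := HWord_surjective p x
    obtain ⟨Y, rfl⟩ := HWord_surjective p y
    refine ⟨Multiplicative.ofAdd (wedge X Y), ?_⟩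
    rw [← map_commutatorElement, commutator_eq_ofComm]
    rfl
  obtain ⟨u, hu⟩ := this hm
  exact ⟨u.toAdd, hu⟩

lemma HWord_ofComm_eq_iff (hp : p ≠ 0) {u v : Fin 6 → ℤ} :
    HWord p (ofComm u) = HWord p (ofComm v) ↔ ∀ i, (u i : ZMod p) = v i := by
  rw [← (H_toModel_injective p 0 1 0 one_ne_zero).eq_iff, H_toModel_HWord_ofComm,
    H_toModel_HWord_ofComm, Model.mk_ofComm_eq_iff hp one_ne_zero]

lemma HWord_ofComm_eq_one_iff (hp : p ≠ 0) {u : Fin 6 → ℤ} :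
    HWord p (ofComm u) = 1 ↔ ∀ i, (u i : ZMod p) = 0 := by
  rw [← (H_toModel_injective p 0 1 0 one_ne_zero).eq_iff, H_toModel_HWord_ofComm, map_one,
    Model.mk_ofComm_eq_one_iff hp one_ne_zero]

lemma HWord_ofComm_ab : HWord p (ofComm ![1, 0, 0, 0, 0, 0]) = ⁅a p, b p⁆ := by
  simp [collectHom_apply, collect, ofComm]

lemma HWord_ofComm_ad : HWord p (ofComm ![0, 0, 1, 0, 0, 0]) = ⁅a p, d p⁆ := by
  simp [collectHom_apply, collect, ofComm]

lemma HWord_ofComm_bd : HWord p (ofComm ![0, 0, 0, 0, 1, 0]) = ⁅b p, d p⁆ := by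
  simp [collectHom_apply, collect, ofComm]

lemma HWord_ofComm_pow (u : Fin 6 → ℤ) : HWord p (ofComm u) ^ p = 1 := by
  rw [← map_pow, ← zpow_natCast, ofComm_zpow]
  apply HWord_eq_one_of_mem
  exact ⟨0, 0, 0, 0, 0, by simp [ofComm]⟩

/-- The functional `ab - ad` vanishes on `H ^ p`. -/
lemma not_mem_powSubgroup (hp : p.Prime) (hodd : p ≠ 2) {u : Fin 6 → ℤ}
    (hu : (u 0 : ZMod p) ≠ u 2) : HWord p (ofComm u) ∉ powSubgroup p (H p) := by
  let S : Subgroup (H p) :=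
    { carrier := {h | ∃ v : Fin 6 → ℤ, (v 0 : ZMod p) = v 2 ∧ HWord p (ofComm v) = h}
      one_mem' := ⟨0, rfl, map_one (HWord p)⟩
      mul_mem' := by
        rintro _ _ ⟨v, hv, rfl⟩ ⟨w, hw, rfl⟩
        exact ⟨v + w, by simp [hv, hw], by rw [ofComm_add, map_mul]⟩
      inv_mem' := by
        rintro _ ⟨v, hv, rfl⟩
        exact ⟨-v, by simp [hv], by rw [ofComm_neg, map_inv]⟩ }
  have hS : powSubgroup p (H p) ≤ S := by
    rw [powSubgroup, Subgroup.closure_le]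
    rintro _ ⟨h, rfl⟩
    obtain ⟨X, rfl⟩ := HWord_surjective p h
    refine ⟨powVec X, by simp [powVec], ?_⟩
    apply H_toModel_injective p 0 1 0 one_ne_zero
    rw [map_pow, H_toModel_HWord_ofComm, H_toModel_HWord, Model.mk_pow hp hodd]
    simp [powVec, dropW]
  intro hmem
  obtain ⟨v, hv, h⟩ := hS hmem
  rw [HWord_ofComm_eq_iff p hp.ne_zero] at h
  exact hu (by rw [← h, ← h, hv])

lemma isAdmissible_zpowers (hp : p.Prime) (hodd : p ≠ 2) {x y : H p} {u : Fin 6 → ℤ}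
    (hxy : HWord p (ofComm u) = ⁅x, y⁆) (hu : (u 0 : ZMod p) ≠ u 2) :
    IsAdmissible p (Subgroup.zpowers ⁅x, y⁆) where
  le_commutator := by
    rw [Subgroup.zpowers_le]
    exact Subgroup.commutator_mem_commutator (Subgroup.mem_top _) (Subgroup.mem_top _)
  card_eq := by
    have := Fact.mk hp
    rw [Nat.card_zpowers]
    refine orderOf_eq_prime (by rw [← hxy, HWord_ofComm_pow]) ?_
    rw [← hxy, Ne, HWord_ofComm_eq_one_iff p hp.ne_zero]
    exact fun h => hu (by rw [h, h])
  not_le_pow := fun h =>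
    not_mem_powSubgroup p hp hodd hu (hxy ▸ h (Subgroup.mem_zpowers _))

/-- For central `z` of order dividing `p`, the assignment `a ↦ a z` respects the relations. -/
lemma exists_H_central_endo {z : H p} (hz : z ∈ Subgroup.center (H p)) (hzp : z ^ p = 1) :
    ∃ f : H p →* H p, f (a p) = a p * z ∧ f (b p) = b p ∧ f (c p) = c p ∧ f (d p) = d p := by
  have key : ∀ x y : H p, ⁅x * z, y⁆ = ⁅x, y⁆ := fun x y => by
    simpa using commutator_mul_center (x := x) (y := y) hz (one_mem _)
  apply exists_H_hom p (H_commutator_mem_center p)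
  · rw [key, ← (H_modelRel p).pow_a,
      Commute.mul_pow (Subgroup.mem_center_iff.1 hz (a p)), hzp, mul_one]
  · rw [key, key, key, (H_modelRel p).pow_b]
  · exact (H_modelRel p).pow_c
  · exact (H_modelRel p).pow_d

/-- The central automorphism `a ↦ a d ^ p`, `b ↦ b`, `c ↦ c`, `d ↦ d` of `H`. -/
lemma exists_H_aut : ∃ γ : MulAut (H p), γ (a p) = a p * d p ^ p ∧ γ (b p) = b p ∧
    γ (c p) = c p ∧ γ (d p) = d p ∧ IsCentralAut γ := by
  have hz : d p ^ p ∈ Subgroup.center (H p) := H_pow_d p ▸ H_commutator_mem_center p _ _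
  have hzp : (d p ^ p) ^ p = 1 := by rw [H_pow_d, ← HWord_ofComm_bd, HWord_ofComm_pow]
  obtain ⟨f, fa, fb, fc, fd⟩ := exists_H_central_endo p hz hzp
  obtain ⟨g, ga, gb, gc, gd⟩ := exists_H_central_endo p (inv_mem hz) (by rw [inv_pow, hzp, inv_one])
  have hgf : g.comp f = MonoidHom.id _ := by
    apply H_hom_ext <;> simp [fa, fb, fc, fd, ga, gb, gc, gd]
  have hfg : f.comp g = MonoidHom.id _ := by
    apply H_hom_ext <;> simp [fa, fb, fc, fd, ga, gb, gc, gd]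
  refine ⟨MonoidHom.toMulEquiv f g hgf hfg, fa, fb, fc, fd, ?_⟩
  -- The elements moved only by central factors form a subgroup.
  let S : Subgroup (H p) :=
    { carrier := {x | x⁻¹ * f x ∈ Subgroup.center (H p)}
      one_mem' := by simp
      mul_mem' := by
        intro x y hx hy
        have : (x * y)⁻¹ * f (x * y) = (x⁻¹ * f x) * (y⁻¹ * f y) := by
          have := Subgroup.mem_center_iff.1 hx y⁻¹
          rw [map_mul, mul_inv_rev, ← mul_assoc (x⁻¹ * f x), ← this]
          group
        change (x * y)⁻¹ * f (x * y) ∈ Subgroup.center (H p)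
        rw [this]
        exact mul_mem hx hy
      inv_mem' := by
        intro x hx
        have : x⁻¹⁻¹ * f x⁻¹ = (x⁻¹ * f x)⁻¹ := by
          have := Subgroup.mem_center_iff.1 (inv_mem hx) x
          rw [map_inv]
          calc x⁻¹⁻¹ * (f x)⁻¹ = x * (x⁻¹ * f x)⁻¹ * x⁻¹ := by group
            _ = _ := by rw [this]; group
        change x⁻¹⁻¹ * f x⁻¹ ∈ Subgroup.center (H p)
        rw [this]
        exact inv_mem hx }
  intro x
  have hS : S = ⊤ := by
    rw [eq_top_iff, ← PresentedGroup.closure_range_of, Subgroup.closure_le]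
    rintro _ ⟨i, rfl⟩
    have mem : ∀ x : H p, x⁻¹ * f x ∈ Subgroup.center (H p) → x ∈ S := fun _ h => h
    fin_cases i
    · exact mem (a p) (by simpa [fa] using hz)
    · exact mem (b p) (by simp [fb, one_mem])
    · exact mem (c p) (by simp [fc, one_mem])
    · exact mem (d p) (by simp [fd, one_mem])
  have hx : x ∈ S := hS ▸ Subgroup.mem_top x
  exact hx

lemma not_isInnerAut (hp : p.Prime) {γ : MulAut (H p)} (ha : γ (a p) = a p * d p ^ p) :
    ¬ IsInnerAut γ := by
  rintro ⟨g, rfl⟩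
  have := Fact.mk hp
  obtain ⟨X, rfl⟩ := HWord_surjective p g
  have h1 : ⁅HWord p X, a p⁆ = ⁅b p, d p⁆ := by
    have hz : d p ^ p ∈ Subgroup.center (H p) := H_pow_d p ▸ H_commutator_mem_center p _ _
    rw [Subgroup.mem_center_iff.1 hz] at ha
    rw [← H_pow_d, commutatorElement_def, ← MulAut.conj_apply, ha, mul_inv_cancel_right]
  have ha' : a p = HWord p genA := (collect_genA).symm
  rw [ha', ← map_commutatorElement, commutator_eq_ofComm, ← HWord_ofComm_bd,
    HWord_ofComm_eq_iff p hp.ne_zero] at h1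
  simpa [wedge, genA] using h1 4

end H

/-! ### The amalgamated semi-direct products as model groups -/

open Word

section Amalgam
variable {p : ℕ}

lemma IsAdmissible.eq_zpowers (hp : p.Prime) {M : Subgroup (H p)} (hM : IsAdmissible p M)
    {m : H p} (hm : m ∈ M) (h1 : m ≠ 1) : M = Subgroup.zpowers m := by
  have := Fact.mk hp
  obtain ⟨u, rfl⟩ := exists_ofComm_of_mem_commutator p (hM.le_commutator hm)
  have hfin : Finite M := Nat.finite_of_card_ne_zero (by rw [hM.card_eq]; exact hp.ne_zero)
  refine (Subgroup.eq_of_le_of_card_ge ((Subgroup.zpowers_le).2 hm) ?_).symm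
  rw [Nat.card_zpowers, orderOf_eq_prime (HWord_ofComm_pow p u) h1, hM.card_eq]

lemma IsAdmissible.exists_generator (hp : p.Prime) {M : Subgroup (H p)} (hM : IsAdmissible p M) :
    ∃ μ : Fin 6 → ℤ, HWord p (ofComm μ) ≠ 1 ∧ M = Subgroup.zpowers (HWord p (ofComm μ)) := by
  have hne : M ≠ ⊥ := by
    rintro rfl
    exact hp.one_lt.ne' (hM.card_eq ▸ Subgroup.card_bot)
  obtain ⟨⟨m, hm⟩, h1⟩ := Subgroup.ne_bot_iff_exists_ne_one.1 hne
  replace h1 : m ≠ 1 := fun h => h1 (Subtype.ext h)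
  obtain ⟨u, rfl⟩ := exists_ofComm_of_mem_commutator p (hM.le_commutator hm)
  exact ⟨u, h1, hM.eq_zpowers hp hm h1⟩

/-- The model groups with `ε = 1` and `q = p²` in which `H` is amalgamated with `⟨w⟩` along
`w ^ p² = [a,b] ^ μ₀ ⋯ [c,d] ^ μ₅`. -/
abbrev AmalgamModel (p : ℕ) (μ : Fin 6 → ℤ) : Type := Model p 1 ((p ^ 2 : ℕ) : ℤ) μ

lemma genW_pow_mk (μ : Fin 6 → ℤ) (n : ℤ) :
    (Model.mk genW : AmalgamModel p μ) ^ (((p ^ 2 : ℕ) : ℤ) * n) = Model.mk (ofComm (n • μ)) := by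
  rw [← map_zpow, Model.mk_zpow_genW_mul]

lemma eq_dropW_mul_genW (X : Word 1) : X = (X.dropW : Word 1) * genW ^ X.xw := by
  rw [genW_zpow]
  ext <;> simp [dropW]

/-- The model groups are amalgamated semi-direct products. -/
lemma isG₂_amalgamModel (hp : p.Prime) {μ : Fin 6 → ℤ} (hμ : HWord p (ofComm μ) ≠ 1) :
    IsG₂ p (Subgroup.zpowers (HWord p (ofComm μ))) (AmalgamModel p μ)
      (H_toModel p 1 ((p ^ 2 : ℕ) : ℤ) μ) (Model.mk genW) := by
  have hq : ((p ^ 2 : ℕ) : ℤ) ≠ 0 := by exact_mod_cast pow_ne_zero 2 hp.ne_zero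
  have hrel := Model.modelRel p 1 ((p ^ 2 : ℕ) : ℤ) μ
  have hinj := H_toModel_injective p 1 ((p ^ 2 : ℕ) : ℤ) μ hq
  have hconj : ∀ x : AmalgamModel p μ, ⁅(Model.mk genW : AmalgamModel p μ), x⁆ = 1 →
      Model.mk genW * x * (Model.mk genW)⁻¹ = x := fun x hx => by
    rw [commutatorElement_eq_one_iff_mul_comm.1 hx, mul_inv_cancel_right]
  have hw1 := genW_pow_mk (p := p) μ 1
  rw [mul_one, one_smul, zpow_natCast] at hw1
  refine ⟨hinj, ?_, ⟨?_, ?_, ?_⟩, ?_, ?_, ?_, ?_⟩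
  · have := Fact.mk hp
    apply orderOf_eq_prime_pow
    · rw [hw1, ← H_toModel_HWord_ofComm, ← map_one (H_toModel p 1 ((p ^ 2 : ℕ) : ℤ) μ)]
      exact fun h => hμ (hinj h)
    · rw [pow_succ p 2, pow_mul, hw1, ← H_toModel_HWord_ofComm, ← map_pow, HWord_ofComm_pow, map_one]
  · -- the image of `H` contains all commutators
    refine ⟨?_⟩
    rintro _ ⟨h, rfl⟩ g
    obtain ⟨X, rfl⟩ := HWord_surjective p h
    obtain ⟨Y, rfl⟩ := Model.mk_surjective g
    refine ⟨HWord p (ofComm (wedge Y (X.dropW : Word 1))) * HWord p X, ?_⟩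
    rw [map_mul, H_toModel_HWord_ofComm, H_toModel_HWord, ← Model.commutator_mk_mk,
      commutatorElement_def]
    group
  · intro g
    obtain ⟨X, rfl⟩ := Model.mk_surjective g
    refine ⟨Model.mk X.dropW, ⟨HWord p X.dropW, ?_⟩, (Model.mk genW) ^ X.xw,
      Subgroup.zpow_mem_zpowers _ _, ?_⟩
    · rw [H_toModel_HWord]; rfl
    · rw [← map_zpow, ← map_mul, ← eq_dropW_mul_genW]
  · apply le_antisymm
    · rintro _ ⟨⟨h, rfl⟩, k, hk⟩
      obtain ⟨X, rfl⟩ := HWord_surjective p h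
      have hk' : (Model.mk genW : AmalgamModel p μ) ^ k =
        H_toModel p 1 ((p ^ 2 : ℕ) : ℤ) μ (HWord p X) := hk
      rw [H_toModel_HWord, ← map_zpow, Model.mk_eq_mk_iff, mem_relSubgroup, genW_zpow] at hk'
      obtain ⟨-, -, -, -, n, ⟨-, -, -, -, h4⟩, -⟩ := hk'
      obtain rfl : k = ((p ^ 2 : ℕ) : ℤ) * -n := by
        simp [dropW] at h4
        push_cast
        linear_combination -h4
      refine ⟨HWord p (ofComm μ) ^ (-n), Subgroup.zpow_mem_zpowers _ _, ?_⟩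
      rw [← hk, ← map_zpow, ofComm_zpow]
      exact (H_toModel_HWord_ofComm p 1 _ μ _).trans (genW_pow_mk μ (-n)).symm
    · rw [MonoidHom.map_zpowers, Subgroup.zpowers_le]
      refine ⟨⟨_, rfl⟩, ((p ^ 2 : ℕ) : ℤ), ?_⟩
      rw [H_toModel_HWord_ofComm, ← hw1]
      exact zpow_natCast _ _
  · rw [map_mul, map_pow, H_toModel_a, H_toModel_d, hrel.pow_d,
      Subgroup.mem_center_iff.1 hrel.bd, ← zpow_one ⁅_, _⁆, ← hrel.wa, commutatorElement_def]
    group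
  · rw [H_toModel_b, hconj _ hrel.wb]
  · rw [H_toModel_c, hconj _ hrel.wc]
  · rw [H_toModel_d, hconj _ hrel.wd]

variable {G : Type u} [Group G] {ι : H p →* G} {w : G} {M : Subgroup (H p)}

lemma IsG₂.commutator_mem_center (h : IsG₂ p M G ι w) (x y : H p) :
    ⁅ι x, ι y⁆ ∈ Subgroup.center G := by
  obtain ⟨γ, γa, γb, γc, γd, hγ⟩ := exists_H_aut p
  have hw : ∀ z, w * ι z * w⁻¹ = ι (γ z) := by
    have : (MulAut.conj w).toMonoidHom.comp ι = ι.comp γ.toMonoidHom := by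
      apply H_hom_ext
      · simpa [γa] using h.conj_a
      · simpa [γb] using h.conj_b
      · simpa [γc] using h.conj_c
      · simpa [γd] using h.conj_d
    exact fun z => DFunLike.congr_fun this z
  have hγc : γ ⁅x, y⁆ = ⁅x, y⁆ := by
    have key : ∀ z, ∃ t ∈ Subgroup.center (H p), γ z = z * t :=
      fun z => ⟨_, hγ z, by group⟩
    obtain ⟨s, hs, hxs⟩ := key x
    obtain ⟨t, ht, hyt⟩ := key y
    rw [map_commutatorElement, hxs, hyt, commutator_mul_center hs ht]
  have hcw : Commute w (ι ⁅x, y⁆) := by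
    rw [commute_iff_eq, ← mul_inv_eq_iff_eq_mul, hw, hγc]
  rw [← map_commutatorElement, Subgroup.mem_center_iff]
  intro g
  obtain ⟨_, ⟨z, rfl⟩, _, ⟨n, rfl⟩, rfl⟩ := h.amalgam.mul_eq g
  have hcz : Commute (ι z) (ι ⁅x, y⁆) := by
    rw [commute_iff_eq, ← map_mul, ← map_mul,
      Subgroup.mem_center_iff.1 (H_commutator_mem_center p x y)]
  exact hcz.mul_left (hcw.zpow_left n)

/-- In an amalgamated product, `w ^ p²` generates the amalgamated subgroup. -/
lemma IsG₂.exists_pow_eq (hp : p.Prime) (hM : IsAdmissible p M) (h : IsG₂ p M G ι w) :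
    ∃ μ : Fin 6 → ℤ, HWord p (ofComm μ) ≠ 1 ∧ M = Subgroup.zpowers (HWord p (ofComm μ)) ∧
      w ^ (p ^ 2) = ι (HWord p (ofComm μ)) := by
  obtain ⟨ν, hν, rfl⟩ := hM.exists_generator hp
  have hmem : ι (HWord p (ofComm ν)) ∈ ι.range ⊓ Subgroup.zpowers w := by
    rw [h.amalgam.inf_eq]
    exact ⟨_, Subgroup.mem_zpowers _, rfl⟩
  obtain ⟨k, hk⟩ := hmem.2
  have hk' : w ^ k = ι (HWord p (ofComm ν)) := hk
  have hp0 : (p : ℤ) ≠ 0 := by exact_mod_cast hp.ne_zero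
  have hdvd : ((p ^ 2 : ℕ) : ℤ) ∣ k := by
    have h1 : w ^ (k * p) = 1 := by
      rw [zpow_mul, hk', zpow_natCast, ← map_pow, HWord_ofComm_pow, map_one]
    rw [← orderOf_dvd_iff_zpow_eq_one, h.orderOf_eq] at h1
    push_cast at h1 ⊢
    rw [pow_succ] at h1
    exact Int.dvd_of_mul_dvd_mul_right hp0 h1
  obtain ⟨j, rfl⟩ := hdvd
  have hj : ¬ (p : ℤ) ∣ j := by
    rintro ⟨l, rfl⟩
    refine hν (h.injective ?_)
    rw [map_one, ← hk', ← orderOf_dvd_iff_zpow_eq_one, h.orderOf_eq]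
    exact ⟨l, by push_cast; ring⟩
  obtain ⟨i, l, hil⟩ : IsCoprime j (p : ℤ) :=
    ((Nat.prime_iff_prime_int.1 hp).coprime_iff_not_dvd.2 hj).symm
  have hwi : w ^ (p ^ 2) = ι (HWord p (ofComm (i • ν))) := by
    have h3 : w ^ (((p ^ 2 : ℕ) : ℤ) * p * l) = 1 := by
      rw [← orderOf_dvd_iff_zpow_eq_one, h.orderOf_eq]
      exact ⟨l, by push_cast; ring⟩
    rw [← ofComm_zpow, map_zpow, map_zpow, ← hk', ← zpow_mul, ← mul_one (w ^ (_ * i)), ← h3,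
      ← zpow_natCast, ← zpow_add]
    congr 1
    push_cast
    linear_combination (-(p : ℤ) ^ 2) * hil
  have hne : HWord p (ofComm (i • ν)) ≠ 1 := by
    intro h1
    rw [h1, map_one, ← orderOf_dvd_iff_pow_eq_one, h.orderOf_eq] at hwi
    exact absurd (Nat.pow_dvd_pow_iff_le_right hp.one_lt |>.1 hwi) (by norm_num)
  refine ⟨i • ν, hne, hM.eq_zpowers hp ?_ hne, hwi⟩
  rw [← ofComm_zpow, map_zpow]
  exact Subgroup.zpow_mem_zpowers _ _

lemma IsG₂.modelRel (h : IsG₂ p M G ι w) {μ : Fin 6 → ℤ}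
    (hμ : w ^ (p ^ 2) = ι (HWord p (ofComm μ))) :
    ModelRel p 1 ((p ^ 2 : ℕ) : ℤ) μ (ι (a p)) (ι (b p)) (ι (c p)) (ι (d p)) w where
  ab := h.commutator_mem_center _ _
  ac := h.commutator_mem_center _ _
  ad := h.commutator_mem_center _ _
  bc := h.commutator_mem_center _ _
  bd := h.commutator_mem_center _ _
  cd := h.commutator_mem_center _ _
  wa := by
    rw [zpow_one, ← map_commutatorElement, commutatorElement_def, h.conj_a, H_pow_d,
      Subgroup.mem_center_iff.1 (H_commutator_mem_center p _ _), map_mul, mul_inv_cancel_right]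
  wb := by rw [commutatorElement_def, h.conj_b, mul_inv_cancel]
  wc := by rw [commutatorElement_def, h.conj_c, mul_inv_cancel]
  wd := by rw [commutatorElement_def, h.conj_d, mul_inv_cancel]
  pow_a := by rw [← map_pow, (H_modelRel p).pow_a, map_commutatorElement]
  pow_b := by
    rw [← map_pow, (H_modelRel p).pow_b]
    simp only [map_mul, map_commutatorElement]
  pow_c := by
    rw [← map_pow, (H_modelRel p).pow_c]
    simp only [map_mul, map_commutatorElement]
  pow_d := by rw [← map_pow, (H_modelRel p).pow_d, map_commutatorElement]
  pow_w := by
    rw [zpow_natCast, hμ, collectHom_apply, collect]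
    simp [ofComm, map_commutatorElement]

/-- Every amalgamated product is isomorphic to its model. The relations of the model hold in it, and
no others do, because `H` embeds, `H ∩ ⟨w⟩ = ⟨w ^ p²⟩` and `w` has order `p ^ 3`. -/
lemma IsG₂.exists_mulEquiv (hp : p.Prime) (hM : IsAdmissible p M) (h : IsG₂ p M G ι w) :
    ∃ μ : Fin 6 → ℤ, HWord p (ofComm μ) ≠ 1 ∧ M = Subgroup.zpowers (HWord p (ofComm μ)) ∧
      Nonempty (AmalgamModel p μ ≃* G) := by
  obtain ⟨μ, hμ, rfl, hw⟩ := h.exists_pow_eq hp hM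
  refine ⟨μ, hμ, rfl, ⟨MulEquiv.ofBijective (Model.lift (h.modelRel hw)) ⟨?_, ?_⟩⟩⟩
  · rw [injective_iff_map_eq_one]
    intro x hx
    obtain ⟨X, rfl⟩ := Model.mk_surjective x
    have hdrop : ∀ Y : Word 1, Model.lift (h.modelRel hw) (Model.mk Y.dropW) =
        ι (HWord p Y.dropW) := by
      intro Y
      rw [Model.lift_mk, collect_dropW, collectHom_apply, map_collect, map_one]
      simp [collect, dropW]
    have hgenW : Model.lift (h.modelRel hw) (Model.mk genW) = w := by
      rw [Model.lift_mk, collect_genW]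
    rw [eq_dropW_mul_genW X, map_mul, map_mul, map_zpow, map_zpow, hdrop, hgenW] at hx
    have hmem : w ^ X.xw ∈ ι.range ⊓ Subgroup.zpowers w := by
      refine ⟨⟨(HWord p X.dropW)⁻¹, ?_⟩, Subgroup.zpow_mem_zpowers _ _⟩
      rw [map_inv, inv_eq_of_mul_eq_one_right hx]
    rw [h.amalgam.inf_eq, MonoidHom.map_zpowers, ← hw] at hmem
    obtain ⟨n, hn⟩ := hmem
    have hn' : (w ^ (p ^ 2)) ^ n = w ^ X.xw := hn
    rw [← hn', hw, ← map_zpow, ← map_mul, ← map_zpow, ← map_mul] at hx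
    have hY := mem_of_HWord_eq_one p (h.injective (hx.trans (map_one ι).symm))
    have hdvd : ((p ^ 3 : ℕ) : ℤ) ∣ X.xw - (p ^ 2 : ℕ) * n := by
      rw [← h.orderOf_eq, orderOf_dvd_iff_zpow_eq_one, zpow_sub, ← hn', ← zpow_natCast, ← zpow_mul,
        mul_inv_cancel]
    obtain ⟨r, hr⟩ := hdvd
    rw [ofComm_zpow] at hY
    obtain ⟨y₀, y₁, y₂, y₃, m, ⟨h0, h1, h2, h3, -⟩, g0, g1, g2, g3, g4, g5⟩ :=
      mem_relSubgroup.1 hY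
    simp [dropW, ofComm] at h0 h1 h2 h3 g0 g1 g2 g3 g4 g5
    rw [Model.mk_eq_one_iff]
    refine ⟨y₀, y₁, y₂, y₃, n + p * r, ⟨h0, h1, h2, h3, ?_⟩, ?_, ?_, ?_, ?_, ?_, ?_⟩
    · push_cast at hr ⊢
      linear_combination hr
    · push_cast; rw [CharP.cast_eq_zero]; linear_combination g0
    · push_cast; rw [CharP.cast_eq_zero]; linear_combination g1
    · push_cast; rw [CharP.cast_eq_zero]; linear_combination g2
    · push_cast; rw [CharP.cast_eq_zero]; linear_combination g3
    · push_cast; rw [CharP.cast_eq_zero]; linear_combination g4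
    · push_cast; rw [CharP.cast_eq_zero]; linear_combination g5
  · intro g
    obtain ⟨_, ⟨z, rfl⟩, _, ⟨n, rfl⟩, rfl⟩ := h.amalgam.mul_eq g
    obtain ⟨X, rfl⟩ := HWord_surjective p z
    refine ⟨Model.mk (X.dropW * genW ^ n), ?_⟩
    rw [map_mul, map_mul, map_zpow, map_zpow, Model.lift_mk, Model.lift_mk, collect_genW,
      collect_dropW, collectHom_apply, map_collect, map_one]

end Amalgam

/-! ### Order and centre -/

section Order
variable {p : ℕ}

lemma eq_of_neg_add_eq_mul {p x y : ℕ} {r : ℤ} (hx : x < p) (hy : y < p) (h : -(x : ℤ) + y = p * r) :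
    x = y := by
  have : x ≡ y [MOD p] := (Nat.modEq_iff_dvd).2 ⟨r, by linarith⟩
  exact this.eq_of_lt_of_lt hx hy

/-- The exponents of `a, b, c, d` are determined modulo `p`, that of `w` modulo `p²`, and those of
the six commutators modulo `p`. -/
lemma card_amalgamModel (hp : p.Prime) (μ : Fin 6 → ℤ) :
    Nat.card (AmalgamModel p μ) = p ^ 12 := by
  have := NeZero.mk hp.ne_zero
  have hp0 : (p : ℤ) ≠ 0 := by exact_mod_cast hp.ne_zero
  have hppos : (0 : ℤ) < p := by exact_mod_cast hp.pos
  have hq0 : ((p ^ 2 : ℕ) : ℤ) ≠ 0 := by exact_mod_cast pow_ne_zero 2 hp.ne_zero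
  have hqpos : (0 : ℤ) < ((p ^ 2 : ℕ) : ℤ) := by exact_mod_cast pow_pos hp.pos 2
  let f : (Fin 4 → Fin p) × Fin (p ^ 2) × (Fin 6 → ZMod p) → AmalgamModel p μ := fun x =>
    Model.mk ⟨(x.1 0 : ℕ), (x.1 1 : ℕ), (x.1 2 : ℕ), (x.1 3 : ℕ), (x.2.1 : ℕ),
      (x.2.2 0).val, (x.2.2 1).val, (x.2.2 2).val, (x.2.2 3).val, (x.2.2 4).val, (x.2.2 5).val⟩
  have hf : Function.Bijective f := by
    constructor
    · rintro ⟨x, n, u⟩ ⟨x', n', u'⟩ h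
      obtain ⟨y₀, y₁, y₂, y₃, m, ⟨h0, h1, h2, h3, h4⟩, g0, g1, g2, g3, g4, g5⟩ :=
        mem_relSubgroup.1 (Model.mk_eq_mk_iff.1 h)
      simp only [mul_xa, mul_xb, mul_xc, mul_xd, mul_xw, inv_xa, inv_xb, inv_xc, inv_xd,
        inv_xw] at h0 h1 h2 h3 h4
      have e0 := eq_of_neg_add_eq_mul (x 0).2 (x' 0).2 h0
      have e1 := eq_of_neg_add_eq_mul (x 1).2 (x' 1).2 h1
      have e2 := eq_of_neg_add_eq_mul (x 2).2 (x' 2).2 h2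
      have e3 := eq_of_neg_add_eq_mul (x 3).2 (x' 3).2 h3
      have e4 := eq_of_neg_add_eq_mul n.2 n'.2 h4
      simp only [e0, e1, e2, e3, e4, neg_add_cancel] at h0 h1 h2 h3 h4
      have z0 : y₀ = 0 := (mul_eq_zero.1 h0.symm).resolve_left hp0
      have z1 : y₁ = 0 := (mul_eq_zero.1 h1.symm).resolve_left hp0
      have z2 : y₂ = 0 := (mul_eq_zero.1 h2.symm).resolve_left hp0
      have z3 : y₃ = 0 := (mul_eq_zero.1 h3.symm).resolve_left hp0
      have z4 : m = 0 := (mul_eq_zero.1 h4.symm).resolve_left hq0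
      subst z0 z1 z2 z3 z4
      simp [e0, e1, e2, e3, e4] at g0 g1 g2 g3 g4 g5
      have hx : x = x' := by
        ext i
        fin_cases i <;> assumption
      have hu : u = u' := by
        ext i
        fin_cases i
        · change u 0 = u' 0
          linear_combination -g0
        · change u 1 = u' 1
          linear_combination -g1
        · change u 2 = u' 2
          linear_combination -g2
        · change u 3 = u' 3
          linear_combination -g3
        · change u 4 = u' 4
          linear_combination -g4
        · change u 5 = u' 5
          linear_combination -g5
      rw [hx, hu, Fin.ext e4]
    · intro x
      obtain ⟨X, rfl⟩ := Model.mk_surjective x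
      have key : ∀ (n : ℕ) (y : ℤ), 0 < (n : ℤ) → ∃ r : Fin n, ((r : ℕ) : ℤ) = y % n :=
        fun n y hn => ⟨⟨(y % n).toNat, by
          have := Int.emod_lt_of_pos y hn; have := Int.emod_nonneg y hn.ne'; omega⟩,
          Int.toNat_of_nonneg (Int.emod_nonneg y hn.ne')⟩
      obtain ⟨r0, h0⟩ := key p X.xa hppos
      obtain ⟨r1, h1⟩ := key p X.xb hppos
      obtain ⟨r2, h2⟩ := key p X.xc hppos
      obtain ⟨r3, h3⟩ := key p X.xd hppos
      obtain ⟨r4, h4⟩ := key (p ^ 2) X.xw hqpos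
      have k0 : X.xa = r0 + p * (X.xa / p) := by rw [h0, Int.emod_add_mul_ediv]
      have k1 : X.xb = r1 + p * (X.xb / p) := by rw [h1, Int.emod_add_mul_ediv]
      have k2 : X.xc = r2 + p * (X.xc / p) := by rw [h2, Int.emod_add_mul_ediv]
      have k3 : X.xd = r3 + p * (X.xd / p) := by rw [h3, Int.emod_add_mul_ediv]
      have k4 : X.xw = r4 + (p ^ 2 : ℕ) * (X.xw / (p ^ 2 : ℕ)) := by
        rw [h4, Int.emod_add_mul_ediv]
      obtain ⟨xa, xb, xc, xd, xw, uab, uac, uad, ubc, ubd, ucd⟩ := X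
      dsimp only at k0 k1 k2 k3 k4
      generalize xa / p = y₀ at k0
      generalize xb / p = y₁ at k1
      generalize xc / p = y₂ at k2
      generalize xd / p = y₃ at k3
      generalize xw / (p ^ 2 : ℕ) = n at k4
      clear h0 h1 h2 h3 h4
      subst k0 k1 k2 k3 k4
      refine ⟨⟨![r0, r1, r2, r3], r4, ![uab + y₁ + n * μ 0, uac + y₀ + y₁ + n * μ 1,
        uad + y₁ + n * μ 2, ubc + y₂ + n * μ 3, ubd + y₂ + y₃ + n * μ 4, ucd + n * μ 5]⟩, ?_⟩
      rw [Model.mk_eq_mk_iff, mem_relSubgroup]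
      refine ⟨y₀, y₁, y₂, y₃, n, ⟨?_, ?_, ?_, ?_, ?_⟩, ?_, ?_, ?_, ?_, ?_, ?_⟩ <;> simp <;> ring
  rw [← Nat.card_congr (Equiv.ofBijective f hf)]
  simp only [Nat.card_eq_fintype_card, Fintype.card_prod, Fintype.card_fun, Fintype.card_fin,
    ZMod.card]
  ring

/-- The central element `w ^ p` is not a product of commutators. -/
lemma center_amalgamModel_ne_commutator (hp : p.Prime) (μ : Fin 6 → ℤ) :
    Subgroup.center (AmalgamModel p μ) ≠ commutator (AmalgamModel p μ) := by
  intro h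
  have hc : (Model.mk (genW ^ (p : ℤ)) : AmalgamModel p μ) ∈ Subgroup.center _ := by
    rw [Subgroup.mem_center_iff]
    intro y
    obtain ⟨Y, rfl⟩ := Model.mk_surjective y
    symm
    rw [← commutatorElement_eq_one_iff_mul_comm, Model.commutator_mk_mk, genW_zpow,
      Model.mk_ofComm_eq_one_iff hp.ne_zero (by exact_mod_cast pow_ne_zero 2 hp.ne_zero)]
    intro i
    fin_cases i <;> simp [wedge]
  rw [h] at hc
  obtain ⟨u, hu⟩ := Model.commutator_le_range _ _ _ _ hc
  have hu' : (Model.mk (ofComm u.toAdd) : AmalgamModel p μ) = Model.mk (genW ^ (p : ℤ)) := hu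
  rw [Model.mk_eq_mk_iff, mem_relSubgroup, genW_zpow] at hu'
  obtain ⟨-, -, -, -, n, ⟨-, -, -, -, h4⟩, -⟩ := hu'
  simp [ofComm, sq, mul_assoc] at h4
  have h5 : (1 : ℤ) = p * n := by
    have hp0 : (p : ℤ) ≠ 0 := by exact_mod_cast hp.ne_zero
    exact mul_left_cancel₀ hp0 (by linarith)
  exact (Nat.prime_iff_prime_int.1 hp).not_dvd_one ⟨n, h5⟩

end Order

section Transfer
universe v
variable {G : Type u} [Group G] {K : Type v} [Group K]

lemma center_eq_commutator_of_mulEquiv (e : K ≃* G)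
    (h : Subgroup.center G = commutator G) : Subgroup.center K = commutator K := by
  have h1 : (commutator K).map e.toMonoidHom = commutator G := by
    rw [commutator_def, Subgroup.map_commutator, Subgroup.map_top_of_surjective _ e.surjective,
      commutator_def]
  have h2 : ∀ x, x ∈ commutator K ↔ e x ∈ commutator G := fun x => by
    rw [← h1]; exact (Subgroup.mem_map_iff_mem (f := e.toMonoidHom) e.injective).symm
  ext x
  rw [h2, ← h, Subgroup.mem_center_iff, Subgroup.mem_center_iff]
  constructor
  · intro hx g
    obtain ⟨y, rfl⟩ := e.surjective g
    rw [← map_mul, ← map_mul, hx]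
  · intro hx y
    apply e.injective
    rw [map_mul, map_mul, hx]

lemma IsMiller.of_mulEquiv (e : K ≃* G) (h : IsMiller K) : IsMiller G := by
  refine ⟨fun hc => h.1 fun x y => e.injective (by rw [map_mul, map_mul, hc]), fun φ ψ => ?_⟩
  apply (MulAut.congr e.symm).injective
  rw [map_mul, map_mul, h.2]

end Transfer

/-! ### A non-commuting pair of automorphisms -/

section NonCentral
variable {p : ℕ}

/-- For `w ^ p² = [a,d] ^ k` with `k k' = 1` modulo `p`, the elements `a w ^ (p k' t)`,
`b w ^ (p k' t)`, `c d ^ t`, `d`, `w` satisfy the same relations as `a`, `b`, `c`, `d`, `w`. -/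
lemma modelRel_shear (hp : p.Prime) (hodd : p ≠ 2) {μ : Fin 6 → ℤ} {k' : ℤ}
    (hμ : ∀ i, (k' * μ i : ZMod p) = (![0, 0, 1, 0, 0, 0] : Fin 6 → ZMod p) i) (t : ℤ) :
    ModelRel p 1 ((p ^ 2 : ℕ) : ℤ) μ
      (Model.mk (genA * genW ^ (p * (k' * t))) : AmalgamModel p μ)
      (Model.mk (genB * genW ^ (p * (k' * t)))) (Model.mk (genC * genD ^ t)) (Model.mk genD)
      (Model.mk genW) := by
  have hq : ((p ^ 2 : ℕ) : ℤ) ≠ 0 := by exact_mod_cast pow_ne_zero 2 hp.ne_zero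
  have hqm : ∀ n : ℤ, (p : ℤ) * (p * n) = ((p ^ 2 : ℕ) : ℤ) * n := fun n => by push_cast; ring
  have h0 : (k' * μ 0 : ZMod p) = 0 := hμ 0
  have h1 : (k' * μ 1 : ZMod p) = 0 := hμ 1
  have h2 : (k' * μ 2 : ZMod p) = 1 := hμ 2
  have h3 : (k' * μ 3 : ZMod p) = 0 := hμ 3
  have h4 : (k' * μ 4 : ZMod p) = 0 := hμ 4
  have h5 : (k' * μ 5 : ZMod p) = 0 := hμ 5
  have hk : (k' : ZMod p) ≠ 0 := by
    have := Fact.mk hp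
    rintro h; rw [h, zero_mul] at h2; exact zero_ne_one h2
  have eA : (genA * genW ^ (p * (k' * t)) : Word 1) =
      ⟨1, 0, 0, 0, p * (k' * t), 0, 0, 0, 0, 0, 0⟩ := by
    rw [genW_zpow]; ext <;> simp [genA]
  have eB : (genB * genW ^ (p * (k' * t)) : Word 1) =
      ⟨0, 1, 0, 0, p * (k' * t), 0, 0, 0, 0, 0, 0⟩ := by
    rw [genW_zpow]; ext <;> simp [genB]
  have eC : (genC * genD ^ t : Word 1) = ⟨0, 0, 1, t, 0, 0, 0, 0, 0, 0, 0⟩ := by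
    rw [genD_zpow]; ext <;> simp [genC]
  rw [eA, eB, eC]
  constructor
  · constructor
    iterate 6 exact Model.commutator_mem_center _ _
    · rw [Model.commutator_mk_mk, Model.commutator_mk_mk, zpow_one,
        Model.mk_ofComm_eq_iff hp.ne_zero hq]
      intro i
      fin_cases i <;> simp [wedge, genD, genW]
    all_goals
      rw [Model.commutator_mk_mk, Model.mk_ofComm_eq_one_iff hp.ne_zero hq]
      intro i
      fin_cases i <;> simp [wedge, genD, genW]
  · rw [Model.commutator_mk_mk, Model.mk_pow hp hodd]
    dsimp only
    rw [hqm, Model.mk_zpow_genW_mul, ← map_mul, ← ofComm_add,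
      Model.mk_ofComm_eq_iff hp.ne_zero hq]
    intro i
    fin_cases i <;> simp [wedge, powVec]
    · linear_combination t * h0
    · linear_combination t * h1
    · linear_combination t * h2
    · linear_combination t * h3
    · linear_combination t * h4
    · linear_combination t * h5
  · simp only [Model.commutator_mk_mk, Model.mk_pow hp hodd]
    rw [hqm, Model.mk_zpow_genW_mul, ← map_mul, ← map_mul, ← map_mul, ← ofComm_add,
      ← ofComm_add, ← ofComm_add, Model.mk_ofComm_eq_iff hp.ne_zero hq]
    intro i
    fin_cases i <;> simp [wedge, powVec, genD]
    · linear_combination t * h0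
    · linear_combination t * h1
    · linear_combination t * h2
    · linear_combination t * h3
    · linear_combination t * h4
    · linear_combination t * h5
  · simp only [Model.commutator_mk_mk, Model.mk_pow hp hodd]
    rw [mul_zero, zpow_zero, map_one, mul_one, ← map_mul, ← ofComm_add,
      Model.mk_ofComm_eq_iff hp.ne_zero hq]
    intro i
    fin_cases i <;> simp [wedge, powVec, genD]
    ring
  · simp only [Model.commutator_mk_mk, Model.mk_pow hp hodd]
    have : (genD : Word 1).xw = 0 := rfl
    rw [this, mul_zero, zpow_zero, map_one, mul_one, Model.mk_ofComm_eq_iff hp.ne_zero hq]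
    intro i
    fin_cases i <;> simp [wedge, powVec, genD]
  · have := Model.mk_zpow_genW_mul (p := p) (ε := 1) (q := ((p ^ 2 : ℕ) : ℤ)) (μ := μ) (n := 1)
    rw [mul_one, one_smul, map_zpow] at this
    rw [this]
    simp only [Model.commutator_mk_mk, ← map_zpow, ofComm_zpow, ← map_mul, ← ofComm_add]
    rw [Model.mk_ofComm_eq_iff hp.ne_zero hq]
    have := Fact.mk hp
    simp only [mul_eq_zero, hk, false_or] at h0 h1 h3 h4 h5
    intro i
    fin_cases i <;> simp [wedge, genD, h0, h1, h3, h4, h5]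

/-- For `w ^ p²` generating `⟨[a,d]⟩`, there is a non-central automorphism, so not all automorphisms
commute with the inner ones. -/
lemma not_isMiller_amalgamModel (hp : p.Prime) (hodd : p ≠ 2) {μ : Fin 6 → ℤ} {k' : ℤ}
    (hμ : ∀ i, (k' * μ i : ZMod p) = (![0, 0, 1, 0, 0, 0] : Fin 6 → ZMod p) i) :
    ¬ IsMiller (AmalgamModel p μ) := by
  have hq : ((p ^ 2 : ℕ) : ℤ) ≠ 0 := by exact_mod_cast pow_ne_zero 2 hp.ne_zero
  have hinv : ∀ s t : ℤ, s + t = 0 → (Model.lift (modelRel_shear hp hodd hμ s)).comp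
      (Model.lift (modelRel_shear hp hodd hμ t)) = MonoidHom.id _ := by
    intro s t hst
    apply Model.hom_ext <;>
      simp only [MonoidHom.comp_apply, MonoidHom.id_apply, Model.lift_mk, collect_genA,
        collect_genB, collect_genC, collect_genD, collect_genW, map_mul, map_zpow]
    · rw [mul_assoc, ← zpow_add, ← mul_add, ← mul_add, hst, mul_zero, mul_zero, zpow_zero, mul_one]
    · rw [mul_assoc, ← zpow_add, ← mul_add, ← mul_add, hst, mul_zero, mul_zero, zpow_zero, mul_one]
    · rw [mul_assoc, ← zpow_add, hst, zpow_zero, mul_one]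
  let φ : MulAut (AmalgamModel p μ) := MonoidHom.toMulEquiv
    (Model.lift (modelRel_shear hp hodd hμ 1)) (Model.lift (modelRel_shear hp hodd hμ (-1)))
    (hinv (-1) 1 (by norm_num)) (hinv 1 (-1) (by norm_num))
  have φa : φ (Model.mk genA) = Model.mk (genA * genW ^ (p * (k' * 1))) := by
    change Model.lift (modelRel_shear hp hodd hμ 1) (Model.mk genA) = _
    rw [Model.lift_mk, collect_genA]
  have φc : φ (Model.mk genC) = Model.mk (genC * genD ^ (1 : ℤ)) := by
    change Model.lift (modelRel_shear hp hodd hμ 1) (Model.mk genC) = _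
    rw [Model.lift_mk, collect_genC]
  intro h
  -- `φ` does not commute with conjugation by `c`, because `c⁻¹ * φ c` is not central.
  have h1 := DFunLike.congr_fun (h.2 φ (MulAut.conj (Model.mk genC))) (Model.mk genA)
  rw [MulAut.mul_apply, MulAut.mul_apply, MulAut.conj_apply, MulAut.conj_apply, map_mul, map_mul,
    map_inv, φa, φc] at h1
  have h2 := congrArg (· * (Model.mk (genA * genW ^ (p * (k' * 1))) : AmalgamModel p μ)⁻¹) h1
  simp only [← commutatorElement_def, Model.commutator_mk_mk] at h2
  rw [Model.mk_ofComm_eq_iff hp.ne_zero hq] at h2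
  have := Fact.mk hp
  simpa [wedge, genA, genC, genD, genW_zpow] using h2 2

end NonCentral

/-! ### Bilinear and power forms over a field -/

section LinearAlgebra
section
variable {F : Type*} [CommRing F]

/-- The commutator form `G₂ / Z(G₂) × G₂ / Z(G₂) → G₂'` in coordinates with respect to
`a, b, c, d, w` and `ab, ac, ad, bc, bd, cd`. -/
def commForm (x y : Fin 5 → F) : Fin 6 → F :=
  ![x 0 * y 1 - x 1 * y 0, x 0 * y 2 - x 2 * y 0, x 0 * y 3 - x 3 * y 0, x 1 * y 2 - x 2 * y 1,
    x 1 * y 3 - x 3 * y 1 + (x 4 * y 0 - x 0 * y 4), x 2 * y 3 - x 3 * y 2]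

/-- The `p`-th power map on `⟨a, b, c, d⟩` in the same coordinates. -/
def powForm (x : Fin 5 → F) : Fin 6 → F := ![x 1, x 0 + x 1, x 1, x 2, x 2 + x 3, 0]

lemma commForm_apply (x y : Fin 5 → F) :
    commForm x y 0 = x 0 * y 1 - x 1 * y 0 ∧ commForm x y 1 = x 0 * y 2 - x 2 * y 0 ∧
    commForm x y 2 = x 0 * y 3 - x 3 * y 0 ∧ commForm x y 3 = x 1 * y 2 - x 2 * y 1 ∧
    commForm x y 4 = x 1 * y 3 - x 3 * y 1 + (x 4 * y 0 - x 0 * y 4) ∧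
    commForm x y 5 = x 2 * y 3 - x 3 * y 2 := ⟨rfl, rfl, rfl, rfl, rfl, rfl⟩

end

variable {F : Type*} [Field F]

/-- A vector centralized by vectors `B`, `C`, `D` of `⟨a, b, c, d⟩` with `[B,C]` and `[B,D]` linearly
independent is a multiple of `w`. -/
lemma eq_zero_of_commForm_eq_zero {B C D W : Fin 5 → F} (hB : B 4 = 0) (hC : C 4 = 0)
    (hD : D 4 = 0) (hWB : ∀ i, commForm W B i = 0) (hWC : ∀ i, commForm W C i = 0)
    (hWD : ∀ i, commForm W D i = 0)
    (hind : ∀ y x : F, (∀ i, y * commForm B C i = x * commForm B D i) → y = 0 ∧ x = 0) :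
    W 0 = 0 ∧ W 1 = 0 ∧ W 2 = 0 ∧ W 3 = 0 := by
  have hBC : ¬ ∀ i, commForm B C i = 0 := fun h =>
    one_ne_zero (hind 1 0 (fun i => by rw [h i]; ring)).1
  obtain ⟨c0, c1, c2, c3, c4, c5⟩ := commForm_apply B C
  obtain ⟨d0, d1, d2, d3, d4, d5⟩ := commForm_apply B D
  have b0 := hWB 0; have b1 := hWB 1; have b2 := hWB 2; have b3 := hWB 3; have b5 := hWB 5
  have e0 := hWC 0; have e1 := hWC 1; have e2 := hWC 2; have e3 := hWC 3; have e5 := hWC 5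
  have f0 := hWD 0; have f1 := hWD 1; have f2 := hWD 2; have f3 := hWD 3; have f5 := hWD 5
  simp only [commForm_apply] at b0 b1 b2 b3 b5 e0 e1 e2 e3 e5 f0 f1 f2 f3 f5
  rw [hB, hC] at c4
  rw [hB, hD] at d4
  have w0 : W 0 = 0 := by
    -- otherwise `B` and `C` are both proportional to `W`
    by_contra h
    refine hBC fun i => (mul_eq_zero.1 ?_).resolve_left (mul_ne_zero h h)
    fin_cases i
    · change W 0 * W 0 * commForm B C 0 = 0
      rw [c0]; linear_combination W 0 * B 0 * e0 - W 0 * C 0 * b0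
    · change W 0 * W 0 * commForm B C 1 = 0
      rw [c1]; linear_combination W 0 * B 0 * e1 - W 0 * C 0 * b1
    · change W 0 * W 0 * commForm B C 2 = 0
      rw [c2]; linear_combination W 0 * B 0 * e2 - W 0 * C 0 * b2
    · change W 0 * W 0 * commForm B C 3 = 0
      rw [c3]
      linear_combination W 0 * B 1 * e1 - W 0 * B 2 * e0 + W 2 * C 0 * b0 - W 1 * C 0 * b1
    · change W 0 * W 0 * commForm B C 4 = 0
      rw [c4]
      linear_combination W 0 * B 1 * e2 - W 0 * B 3 * e0 + W 3 * C 0 * b0 - W 1 * C 0 * b2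
    · change W 0 * W 0 * commForm B C 5 = 0
      rw [c5]
      linear_combination W 0 * B 2 * e2 - W 0 * B 3 * e1 + W 3 * C 0 * b1 - W 2 * C 0 * b2
  rw [w0] at b0 b1 b2 e0 e1 e2 f0 f1 f2
  have w2 : W 2 = 0 := by
    -- otherwise `B` and `C` are again proportional to `W`, up to the coordinate of `w`
    by_contra h
    have B0 : B 0 = 0 := (mul_eq_zero.1 (show W 2 * B 0 = 0 by linear_combination -b1)).resolve_left h
    have C0 : C 0 = 0 := (mul_eq_zero.1 (show W 2 * C 0 = 0 by linear_combination -e1)).resolve_left h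
    refine hBC fun i => (mul_eq_zero.1 ?_).resolve_left (mul_ne_zero h h)
    fin_cases i
    · change W 2 * W 2 * commForm B C 0 = 0
      rw [c0, B0, C0]; ring
    · change W 2 * W 2 * commForm B C 1 = 0
      rw [c1, B0, C0]; ring
    · change W 2 * W 2 * commForm B C 2 = 0
      rw [c2, B0, C0]; ring
    · change W 2 * W 2 * commForm B C 3 = 0
      rw [c3]; linear_combination W 2 * (-C 2 * b3 + B 2 * e3)
    · change W 2 * W 2 * commForm B C 4 = 0
      rw [c4, B0, C0]
      linear_combination -W 2 * C 3 * b3 - W 2 * C 1 * b5 + B 2 * W 1 * e5 + B 2 * W 3 * e3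
    · change W 2 * W 2 * commForm B C 5 = 0
      rw [c5]; linear_combination W 2 * (-C 2 * b5 + B 2 * e5)
  rw [w2] at b3 b5 e3 e5 f3 f5
  -- otherwise `B`, `C`, `D` lie in the plane `⟨b, d⟩`
  have hplane : ∀ y : F, y = W 1 ∨ y = W 3 → y = 0 := by
    intro y hy
    by_contra h
    have B0 : B 0 = 0 := (mul_eq_zero.1 (show y * B 0 = 0 by
      rcases hy with rfl | rfl
      · linear_combination -b0
      · linear_combination -b2)).resolve_left h
    have C0 : C 0 = 0 := (mul_eq_zero.1 (show y * C 0 = 0 by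
      rcases hy with rfl | rfl
      · linear_combination -e0
      · linear_combination -e2)).resolve_left h
    have D0 : D 0 = 0 := (mul_eq_zero.1 (show y * D 0 = 0 by
      rcases hy with rfl | rfl
      · linear_combination -f0
      · linear_combination -f2)).resolve_left h
    have B2 : B 2 = 0 := (mul_eq_zero.1 (show y * B 2 = 0 by
      rcases hy with rfl | rfl
      · linear_combination b3
      · linear_combination -b5)).resolve_left h
    have C2 : C 2 = 0 := (mul_eq_zero.1 (show y * C 2 = 0 by
      rcases hy with rfl | rfl
      · linear_combination e3
      · linear_combination -e5)).resolve_left h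
    have D2 : D 2 = 0 := (mul_eq_zero.1 (show y * D 2 = 0 by
      rcases hy with rfl | rfl
      · linear_combination f3
      · linear_combination -f5)).resolve_left h
    have hBC4 : commForm B C 4 = 0 := (hind (commForm B D 4) (commForm B C 4) (by
      intro i
      fin_cases i <;> simp [commForm, B0, C0, D0, B2, C2, D2, hB, hC, hD]
      ring)).2
    refine hBC fun i => ?_
    fin_cases i
    · simp [commForm, B0, C0]
    · simp [commForm, B0, C0]
    · simp [commForm, B0, C0]
    · simp [commForm, B2, C2]
    · exact hBC4
    · simp [commForm, B2, C2]
  exact ⟨w0, hplane _ (Or.inl rfl), w2, hplane _ (Or.inr rfl)⟩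

/-- The only linear substitution of `a, b, c, d, w` compatible with the commutators and the `p`-th
powers, and preserving the line `[a,b]`, is the identity. -/
lemma rigidity {A B C D W : Fin 5 → F} {k na nb nc nd : F} (hk : k ≠ 0)
    (hA : A 4 = 0) (hB : B 4 = 0) (hC : C 4 = 0) (hD : D 4 = 0)
    (hWA : ∀ i, commForm W A i = commForm B D i) (hWB : ∀ i, commForm W B i = 0)
    (hWC : ∀ i, commForm W C i = 0) (hWD : ∀ i, commForm W D i = 0)
    (hAB : ∀ i, commForm A B i = (![W 4, 0, 0, 0, 0, 0] : Fin 6 → F) i)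
    (hpA : ∀ i, powForm A i + na * (![k, 0, 0, 0, 0, 0] : Fin 6 → F) i = commForm A C i)
    (hpB : ∀ i, powForm B i + nb * (![k, 0, 0, 0, 0, 0] : Fin 6 → F) i =
      commForm A B i + commForm A C i + commForm A D i)
    (hpC : ∀ i, powForm C i + nc * (![k, 0, 0, 0, 0, 0] : Fin 6 → F) i =
      commForm B C i + commForm B D i)
    (hpD : ∀ i, powForm D i + nd * (![k, 0, 0, 0, 0, 0] : Fin 6 → F) i = commForm B D i)
    (hind : ∀ y x : F, (∀ i, y * commForm B C i = x * commForm B D i) → y = 0 ∧ x = 0) :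
    A = ![1, 0, 0, 0, 0] ∧ B = ![0, 1, 0, 0, 0] ∧ C = ![0, 0, 1, 0, 0] ∧ D = ![0, 0, 0, 1, 0] ∧
      W = ![0, 0, 0, 0, 1] ∧ na = 0 ∧ nb = 0 ∧ nc = 0 ∧ nd = 0 := by
  obtain ⟨w0, w1, w2, w3⟩ := eq_zero_of_commForm_eq_zero hB hC hD hWB hWC hWD hind
  have hBD : ¬ ∀ i, commForm B D i = 0 := fun h =>
    one_ne_zero (hind 0 1 (fun i => by rw [h i]; ring)).2
  simp only [← hWA] at hBD
  simp only [Fin.forall_fin_succ, commForm, powForm, hA, hB, hC, hD, w0, w1,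
    w2, w3] at hWA hWB hWC hWD hAB hpA hpB hpC hpD hBD
  simp at hWA hWB hWC hWD hAB hpA hpB hpC hpD hBD
  obtain ⟨hs, hα⟩ := hBD
  have b0 : B 0 = 0 := hWB.resolve_left hs
  have c0 : C 0 = 0 := hWC.resolve_left hs
  have d0 : D 0 = 0 := hWD.resolve_left hs
  obtain ⟨-, -, -, x3, x4, -⟩ := hWA
  obtain ⟨y0, y1, y2, y3, y4, -⟩ := hAB
  obtain ⟨p0, p1, p2, -⟩ := hpA
  obtain ⟨q0, q1, q2, q3, -⟩ := hpB
  obtain ⟨r0, r1, -⟩ := hpC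
  obtain ⟨s0, s1, -, -, s4, -⟩ := hpD
  -- `⟨a, b⟩ ∩ ⟨b, d⟩ = ⟨b⟩` is preserved
  have b1 : B 1 ≠ 0 := fun h => hs (by rw [← y0, b0, h]; ring)
  have b2 : B 2 = 0 := by simpa [b0, hα] using y1
  have b3 : B 3 = 0 := by simpa [b0, hα] using y2
  have a2 : A 2 = 0 := by simpa [b2, b1] using y3
  have a3 : A 3 = 0 := by simpa [b3, b1] using y4
  have d2 : D 2 = 0 := by simpa [b2, b1] using x3.symm
  have d1 : D 1 = 0 := by simpa [b0, d0, b2] using s1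
  have d3 : D 3 ≠ 0 := fun h => mul_ne_zero hs hα (by rw [x4, h, b3]; ring)
  -- the `p`-th powers of `d`, `b`, `a`, `c` determine the remaining coefficients
  have b1' : B 1 = 1 := by
    rw [d2, b3, zero_add, zero_mul, sub_zero] at s4
    exact mul_right_cancel₀ d3 (by rw [one_mul, ← s4])
  have q1' : A 0 * C 2 = 1 := by
    rw [b0, b1', b2, a2, c0, d0, d2] at q1
    linear_combination -q1
  have a1 : A 1 = 0 := by
    have hc2 : C 2 ≠ 0 := right_ne_zero_of_mul_eq_one q1'
    refine (mul_eq_zero.1 (?_ : A 1 * C 2 = 0)).resolve_right hc2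
    rw [a2, b2, d2] at q3
    linear_combination -q3
  have a0 : A 0 = 1 := by
    rw [a1, a2, c0] at p1
    linear_combination p1 + q1'
  have c2 : C 2 = 1 := by rw [← q1', a0, one_mul]
  have c3 : C 3 = 0 := by
    rw [a1, a3, a0, c0] at p2
    linear_combination -p2
  have d3' : D 3 = 1 := by
    rw [a0, a3, b0, b1', b3, c0, c3, d0] at q2
    linear_combination -q2
  have c1 : C 1 = 0 := by
    rw [b0, b2, c0, d0] at r1
    linear_combination r1
  have w4 : W 4 = 1 := by
    rw [← y0, a0, b1', b0]; ring
  refine ⟨?_, ?_, ?_, ?_, ?_, ?_, ?_, ?_, ?_⟩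
  · ext i; fin_cases i <;> assumption
  · ext i; fin_cases i <;> assumption
  · ext i; fin_cases i <;> assumption
  · ext i; fin_cases i <;> assumption
  · ext i; fin_cases i <;> assumption
  · simpa [a0, a1, c0, c1, hk] using p0
  · simpa [a0, a1, b0, b1', c0, c1, d0, d1, hk] using q0
  · simpa [b0, b1', c0, c1, d0, d1, hk] using r0
  · simpa [b0, b1', d0, d1, hk] using s0

end LinearAlgebra

/-! ### Automorphisms when `M = ⟨[a,b]⟩` -/

section Miller
variable {p : ℕ} {μ : Fin 6 → ℤ}

/-- The exponents of `a, b, c, d, w` modulo `p`. -/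
def expVec (p : ℕ) (X : Word 1) : Fin 5 → ZMod p := ![X.xa, X.xb, X.xc, X.xd, X.xw]

lemma wedge_cast (X Y : Word 1) (i : Fin 6) :
    (wedge X Y i : ZMod p) = commForm (F := ZMod p) (expVec p X) (expVec p Y) i := by
  fin_cases i <;> simp [wedge, commForm, expVec]

lemma powVec_cast (X : Word 1) (i : Fin 6) :
    (powVec X i : ZMod p) = powForm (F := ZMod p) (expVec p X) i := by
  fin_cases i <;> simp [powVec, powForm, expVec]

/-- The images of `a, b, c, d, w` under an endomorphism satisfy the relations of the model. -/
lemma modelRel_map {ε q : ℤ} [Fact ((q * ε : ZMod p) = 0)] {A B C D W : Model p ε q μ}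
    (h : ModelRel p ε q μ A B C D W) (f : Model p ε q μ →* Model p ε q μ) :
    ModelRel p ε q μ (f A) (f B) (f C) (f D) (f W) where
  ab := Model.commutator_mem_center _ _
  ac := Model.commutator_mem_center _ _
  ad := Model.commutator_mem_center _ _
  bc := Model.commutator_mem_center _ _
  bd := Model.commutator_mem_center _ _
  cd := Model.commutator_mem_center _ _
  wa := by simp only [← map_commutatorElement, ← map_zpow, h.wa]
  wb := by simp only [← map_commutatorElement, h.wb, map_one]
  wc := by simp only [← map_commutatorElement, h.wc, map_one]
  wd := by simp only [← map_commutatorElement, h.wd, map_one]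
  pow_a := by simp only [← map_commutatorElement, ← map_pow, h.pow_a]
  pow_b := by simp only [← map_commutatorElement, ← map_pow, ← map_mul, h.pow_b]
  pow_c := by simp only [← map_commutatorElement, ← map_pow, ← map_mul, h.pow_c]
  pow_d := by simp only [← map_commutatorElement, ← map_pow, h.pow_d]
  pow_w := by simp only [← map_commutatorElement, ← map_zpow, ← map_mul, h.pow_w]

/-- A word with exponents of `a, b, c, d` divisible by `p` and of `w` divisible by `q` is a product
of commutators. -/
lemma Model.exists_ofComm {ε q : ℤ} [Fact ((q * ε : ZMod p) = 0)] {X : Word ε}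
    (h0 : (X.xa : ZMod p) = 0) (h1 : (X.xb : ZMod p) = 0) (h2 : (X.xc : ZMod p) = 0)
    (h3 : (X.xd : ZMod p) = 0) (h4 : q ∣ X.xw) :
    ∃ u, (Model.mk X : Model p ε q μ) = Model.mk (ofComm u) := by
  obtain ⟨xa, xb, xc, xd, xw, uab, uac, uad, ubc, ubd, ucd⟩ := X
  obtain ⟨y₀, rfl⟩ := (ZMod.intCast_zmod_eq_zero_iff_dvd _ _).1 h0
  obtain ⟨y₁, rfl⟩ := (ZMod.intCast_zmod_eq_zero_iff_dvd _ _).1 h1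
  obtain ⟨y₂, rfl⟩ := (ZMod.intCast_zmod_eq_zero_iff_dvd _ _).1 h2
  obtain ⟨y₃, rfl⟩ := (ZMod.intCast_zmod_eq_zero_iff_dvd _ _).1 h3
  obtain ⟨n, rfl⟩ := h4
  refine ⟨![uab + y₁ + n * μ 0, uac + y₀ + y₁ + n * μ 1, uad + y₁ + n * μ 2, ubc + y₂ + n * μ 3,
    ubd + y₂ + y₃ + n * μ 4, ucd + n * μ 5], ?_⟩
  symm
  rw [Model.mk_eq_mk_iff, mem_relSubgroup]
  refine ⟨y₀, y₁, y₂, y₃, n, ⟨?_, ?_, ?_, ?_, ?_⟩, ?_, ?_, ?_, ?_, ?_, ?_⟩ <;>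
    simp [ofComm] <;> ring

lemma pow_sq_mk (hp : p.Prime) (hodd : p ≠ 2) (X : Word 1) :
    (Model.mk X : AmalgamModel p μ) ^ ((p ^ 2 : ℕ) : ℤ) = Model.mk (ofComm (X.xw • μ)) := by
  have h0 : (Model.mk X : AmalgamModel p μ) ^ p ^ 2 = (Model.mk X ^ p) ^ p := by
    rw [← pow_mul]; congr 1; ring
  rw [zpow_natCast, h0, Model.mk_pow hp hodd, ← map_mul, Model.mk_pow hp hodd, genW_zpow]
  have h1 : powVec (ofComm (powVec X) * ⟨0, 0, 0, 0, p * X.xw, 0, 0, 0, 0, 0, 0⟩ : Word 1) = 0 := by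
    ext i
    fin_cases i <;> simp [powVec, ofComm]
  have h2 : (p : ℤ) * (ofComm (powVec X) * ⟨0, 0, 0, 0, p * X.xw, 0, 0, 0, 0, 0, 0⟩ : Word 1).xw =
      ((p ^ 2 : ℕ) : ℤ) * X.xw := by
    simp [ofComm]; ring
  rw [h1, h2, Model.mk_zpow_genW_mul, ← map_mul, ← ofComm_add, zero_add]

/-- If `w ^ p²` spans `⟨[a,b]⟩`, every automorphism is central: it multiplies `a, b, c, d` by
products of commutators, and `w` by a power of `w ^ p` and a product of commutators. -/
lemma exists_central_form (hp : p.Prime) (hodd : p ≠ 2) {k : ZMod p} (hk : k ≠ 0)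
    (hμ : ∀ i, (μ i : ZMod p) = (![k, 0, 0, 0, 0, 0] : Fin 6 → ZMod p) i)
    (φ : MulAut (AmalgamModel p μ)) :
    (∃ u, φ (Model.mk genA) = Model.mk genA * Model.mk (ofComm u)) ∧
    (∃ u, φ (Model.mk genB) = Model.mk genB * Model.mk (ofComm u)) ∧
    (∃ u, φ (Model.mk genC) = Model.mk genC * Model.mk (ofComm u)) ∧
    (∃ u, φ (Model.mk genD) = Model.mk genD * Model.mk (ofComm u)) ∧
    ∃ (s : ℤ) (u : Fin 6 → ℤ), (s : ZMod p) = 1 ∧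
      φ (Model.mk genW) = Model.mk genW ^ s * Model.mk (ofComm u) := by
  have := Fact.mk hp
  have hp0 : (p : ℤ) ≠ 0 := by exact_mod_cast hp.ne_zero
  have hq : ((p ^ 2 : ℕ) : ℤ) ≠ 0 := by exact_mod_cast pow_ne_zero 2 hp.ne_zero
  obtain ⟨A, hA⟩ := Model.mk_surjective (φ (Model.mk genA))
  obtain ⟨B, hB⟩ := Model.mk_surjective (φ (Model.mk genB))
  obtain ⟨C, hC⟩ := Model.mk_surjective (φ (Model.mk genC))
  obtain ⟨D, hD⟩ := Model.mk_surjective (φ (Model.mk genD))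
  obtain ⟨W, hW⟩ := Model.mk_surjective (φ (Model.mk genW))
  have hr := modelRel_map (Model.modelRel p 1 ((p ^ 2 : ℕ) : ℤ) μ) φ.toMonoidHom
  change ModelRel p 1 _ μ (φ _) (φ _) (φ _) (φ _) (φ _) at hr
  rw [← hA, ← hB, ← hC, ← hD, ← hW] at hr
  have hxw : ∀ {x n : ℤ}, p * x = ((p ^ 2 : ℕ) : ℤ) * n → x = p * n := fun h =>
    mul_left_cancel₀ hp0 (by rw [h]; push_cast; ring)
  -- the relations between the images, modulo `p`
  have ra := hr.pow_a
  have rb := hr.pow_b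
  have rc := hr.pow_c
  have rd := hr.pow_d
  have relW := hr.pow_w
  simp only [Model.commutator_mk_mk, ← map_mul, ← ofComm_add] at ra rb rc rd
  simp only [Model.commutator_mk_mk, ← map_zpow, ofComm_zpow, ← map_mul, ← ofComm_add] at relW
  rw [map_zpow, pow_sq_mk hp hodd, Model.mk_ofComm_eq_iff hp.ne_zero hq] at relW
  obtain ⟨na, wa, ea⟩ := Model.pow_eq_mk_ofComm hp hodd hq ra
  obtain ⟨nb, wb, eb⟩ := Model.pow_eq_mk_ofComm hp hodd hq rb
  obtain ⟨nc, wc, ec⟩ := Model.pow_eq_mk_ofComm hp hodd hq rc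
  obtain ⟨nd, wd, ed⟩ := Model.pow_eq_mk_ofComm hp hodd hq rd
  replace wa := hxw wa
  replace wb := hxw wb
  replace wc := hxw wc
  replace wd := hxw wd
  have cwa := hr.wa
  have cwb := hr.wb
  have cwc := hr.wc
  have cwd := hr.wd
  rw [zpow_one, Model.commutator_mk_mk, Model.commutator_mk_mk,
    Model.mk_ofComm_eq_iff hp.ne_zero hq] at cwa
  rw [Model.commutator_mk_mk, Model.mk_ofComm_eq_one_iff hp.ne_zero hq] at cwb cwc cwd
  obtain ⟨vA, vB, vC, vD, vW, za, zb, zc, zd⟩ := rigidity (A := expVec p A) (B := expVec p B)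
    (C := expVec p C) (D := expVec p D) (W := expVec p W) (na := (na : ZMod p)) (nb := (nb : ZMod p))
    (nc := (nc : ZMod p)) (nd := (nd : ZMod p)) hk
    (by simp [expVec, wa]) (by simp [expVec, wb]) (by simp [expVec, wc]) (by simp [expVec, wd])
    (by simpa only [wedge_cast] using cwa) (by simpa only [wedge_cast] using cwb)
    (by simpa only [wedge_cast] using cwc) (by simpa only [wedge_cast] using cwd)
    (by
      intro i
      have := relW i
      have m0 : (μ 0 : ZMod p) = k := hμ 0
      have m1 : (μ 1 : ZMod p) = 0 := hμ 1
      have m2 : (μ 2 : ZMod p) = 0 := hμ 2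
      have m3 : (μ 3 : ZMod p) = 0 := hμ 3
      have m4 : (μ 4 : ZMod p) = 0 := hμ 4
      have m5 : (μ 5 : ZMod p) = 0 := hμ 5
      simp only [Pi.add_apply, Pi.smul_apply, smul_eq_mul, Int.cast_add, Int.cast_mul, wedge_cast,
        m0, m1, m2, m3, m4, m5, hμ i, zero_mul, add_zero] at this
      apply mul_left_cancel₀ hk
      rw [← this]
      fin_cases i <;> simp [expVec, mul_comm])
    (by intro i; rw [← hμ, ← powVec_cast, ← wedge_cast, ea])
    (by intro i; rw [← hμ, ← powVec_cast, ← wedge_cast, ← wedge_cast, ← wedge_cast, eb]; simp)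
    (by intro i; rw [← hμ, ← powVec_cast, ← wedge_cast, ← wedge_cast, ec]; simp)
    (by intro i; rw [← hμ, ← powVec_cast, ← wedge_cast, ed])
    (by
      -- `φ` is injective on products of `[b,c]` and `[b,d]`
      intro y x h
      obtain ⟨y, rfl⟩ := ZMod.intCast_surjective y
      obtain ⟨x, rfl⟩ := ZMod.intCast_surjective x
      have h1 : (Model.mk (ofComm (y • wedge B C)) : AmalgamModel p μ) =
          Model.mk (ofComm (x • wedge B D)) := by
        rw [Model.mk_ofComm_eq_iff hp.ne_zero hq]
        intro i
        simpa [wedge_cast] using h i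
      have h2 : φ (Model.mk (ofComm (y • wedge (genB : Word 1) genC))) =
          φ (Model.mk (ofComm (x • wedge (genB : Word 1) genD))) := by
        simp only [← ofComm_zpow, map_zpow, ← Model.commutator_mk_mk, map_commutatorElement,
          ← hB, ← hC, ← hD] at h1 ⊢
        exact h1
      replace h1 := φ.injective h2
      rw [Model.mk_ofComm_eq_iff hp.ne_zero hq] at h1
      have h3 := h1 3
      have h4 := h1 4
      simp [wedge, genB, genC, genD] at h3 h4
      exact ⟨h3, h4.symm⟩)
  have hdvd : ∀ {x n : ℤ}, x = p * n → (n : ZMod p) = 0 → ((p ^ 2 : ℕ) : ℤ) ∣ x := by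
    intro x n hx hn
    obtain ⟨m, rfl⟩ := (ZMod.intCast_zmod_eq_zero_iff_dvd _ _).1 hn
    exact ⟨m, by rw [hx]; push_cast; ring⟩
  have key : ∀ {X Y : Word 1}, expVec p Y = expVec p X → ((p ^ 2 : ℕ) : ℤ) ∣ -X.xw + Y.xw →
      ∃ u, (Model.mk Y : AmalgamModel p μ) = Model.mk X * Model.mk (ofComm u) := by
    intro X Y h hw
    have h0 : (Y.xa : ZMod p) = X.xa := congrFun h 0
    have h1 : (Y.xb : ZMod p) = X.xb := congrFun h 1
    have h2 : (Y.xc : ZMod p) = X.xc := congrFun h 2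
    have h3 : (Y.xd : ZMod p) = X.xd := congrFun h 3
    obtain ⟨u, hu⟩ := Model.exists_ofComm (p := p) (ε := 1) (q := ((p ^ 2 : ℕ) : ℤ)) (μ := μ)
      (X := X⁻¹ * Y) (by simp [h0]) (by simp [h1]) (by simp [h2]) (by simp [h3]) hw
    exact ⟨u, by rw [← hu, map_mul, map_inv, mul_inv_cancel_left]⟩
  refine ⟨?_, ?_, ?_, ?_, W.xw, ?_⟩
  · rw [← hA]
    exact key (by rw [vA]; simp [expVec, genA]) (by simpa [genA] using hdvd wa za)
  · rw [← hB]
    exact key (by rw [vB]; simp [expVec, genB]) (by simpa [genB] using hdvd wb zb)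
  · rw [← hC]
    exact key (by rw [vC]; simp [expVec, genC]) (by simpa [genC] using hdvd wc zc)
  · rw [← hD]
    exact key (by rw [vD]; simp [expVec, genD]) (by simpa [genD] using hdvd wd zd)
  · have hs : (W.xw : ZMod p) = 1 := congrFun vW 4
    obtain ⟨u, hu⟩ := key (X := genW ^ W.xw) (Y := W)
      (by rw [vW, genW_zpow]; simp [expVec, hs]) (by simp [genW_zpow])
    exact ⟨u, hs, by rw [← hW, hu, map_zpow]⟩

/-- For `w ^ p²` generating `⟨[a,b]⟩`, all automorphisms commute. -/
lemma isMiller_amalgamModel (hp : p.Prime) (hodd : p ≠ 2) {k : ZMod p} (hk : k ≠ 0)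
    (hμ : ∀ i, (μ i : ZMod p) = (![k, 0, 0, 0, 0, 0] : Fin 6 → ZMod p) i) :
    IsMiller (AmalgamModel p μ) := by
  have := Fact.mk hp
  have hq : ((p ^ 2 : ℕ) : ℤ) ≠ 0 := by exact_mod_cast pow_ne_zero 2 hp.ne_zero
  have hcen := Model.mk_ofComm_mem_center (p := p) (ε := 1) (q := ((p ^ 2 : ℕ) : ℤ)) (μ := μ)
  refine ⟨fun h => ?_, fun φ ψ => ?_⟩
  · have h1 := commutatorElement_eq_one_iff_mul_comm.2
      (h (Model.mk genA : AmalgamModel p μ) (Model.mk genB))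
    rw [Model.commutator_mk_mk, Model.mk_ofComm_eq_one_iff hp.ne_zero hq] at h1
    simpa [wedge, genA, genB] using h1 0
  -- a central automorphism fixes all commutators
  have hfix : ∀ (φ : MulAut (AmalgamModel p μ)) (u : Fin 6 → ℤ),
      φ (Model.mk (ofComm u)) = Model.mk (ofComm u) := by
    intro φ u
    obtain ⟨⟨uA, hA⟩, ⟨uB, hB⟩, ⟨uC, hC⟩, ⟨uD, hD⟩, -⟩ := exists_central_form hp hodd hk hμ φ
    rw [Model.mk_eq_collect]
    change φ.toMonoidHom _ = _
    rw [map_collect]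
    change collect (φ _) (φ _) (φ _) (φ _) (φ _) _ = _
    rw [hA, hB, hC, hD]
    simp only [collect, commutator_mul_center (hcen _) (hcen _)]
    simp only [ofComm, zpow_zero]
  have hpow : ∀ (s : ℤ) (u : Fin 6 → ℤ), (s : ZMod p) = 1 →
      (Model.mk (ofComm u) : AmalgamModel p μ) ^ s = Model.mk (ofComm u) := by
    intro s u hs
    rw [← map_zpow, ofComm_zpow, Model.mk_ofComm_eq_iff hp.ne_zero hq]
    simp [hs]
  have hcomm : ∀ (u : Fin 6 → ℤ) (x : AmalgamModel p μ), Commute (Model.mk (ofComm u)) x :=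
    fun u x => (Subgroup.mem_center_iff.1 (hcen u) x).symm
  obtain ⟨⟨uA, hA⟩, ⟨uB, hB⟩, ⟨uC, hC⟩, ⟨uD, hD⟩, s, uW, hs, hW⟩ :=
    exists_central_form hp hodd hk hμ φ
  obtain ⟨⟨vA, kA⟩, ⟨vB, kB⟩, ⟨vC, kC⟩, ⟨vD, kD⟩, t, vW, ht, kW⟩ :=
    exists_central_form hp hodd hk hμ ψ
  have : (φ * ψ).toMonoidHom = (ψ * φ).toMonoidHom := by
    apply Model.hom_ext <;> change φ (ψ _) = ψ (φ _)
    · rw [kA, hA, map_mul, map_mul, hA, kA, hfix, hfix, mul_assoc, mul_assoc, (hcomm uA _).eq]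
    · rw [kB, hB, map_mul, map_mul, hB, kB, hfix, hfix, mul_assoc, mul_assoc, (hcomm uB _).eq]
    · rw [kC, hC, map_mul, map_mul, hC, kC, hfix, hfix, mul_assoc, mul_assoc, (hcomm uC _).eq]
    · rw [kD, hD, map_mul, map_mul, hD, kD, hfix, hfix, mul_assoc, mul_assoc, (hcomm uD _).eq]
    · rw [kW, hW, map_mul, map_mul, map_zpow, map_zpow, hW, kW, hfix, hfix,
        (hcomm uW _).symm.mul_zpow, (hcomm vW _).symm.mul_zpow, hpow t _ ht, hpow s _ hs,
        mul_assoc, mul_assoc, (hcomm uW _).eq, ← zpow_mul, ← zpow_mul, mul_comm s t]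
  exact MulEquiv.toMonoidHom_injective this

end Miller

/-! ### Proof of the theorem -/

section Conclusion
variable {p : ℕ}

lemma exists_coeff_of_zpowers_eq (hp : p.Prime) {μ v : Fin 6 → ℤ} {x : H p}
    (hx : HWord p (ofComm v) = x) (hne : HWord p (ofComm μ) ≠ 1)
    (h : Subgroup.zpowers (HWord p (ofComm μ)) = Subgroup.zpowers x) :
    ∃ k : ZMod p, k ≠ 0 ∧ ∀ i, (μ i : ZMod p) = k * v i := by
  obtain ⟨j, hj⟩ : HWord p (ofComm μ) ∈ Subgroup.zpowers x := h ▸ Subgroup.mem_zpowers _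
  have h1 : HWord p (ofComm (j • v)) = HWord p (ofComm μ) := by
    rw [← ofComm_zpow, map_zpow, hx]; exact hj
  rw [HWord_ofComm_eq_iff p hp.ne_zero] at h1
  have h2 : ∀ i, (μ i : ZMod p) = j * v i := fun i => by rw [← h1]; simp
  refine ⟨j, fun hk => hne ((HWord_ofComm_eq_one_iff p hp.ne_zero).2 fun i => ?_), h2⟩
  rw [h2, hk, zero_mul]

lemma IsG₂.properties (hp : p.Prime) (hodd : p ≠ 2) {G : Type u} [Group G] {ι : H p →* G} {w : G}
    {M : Subgroup (H p)} (hM : IsAdmissible p M) (h : IsG₂ p M G ι w) :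
    IsPGroup p G ∧ Nat.card G = p ^ 12 ∧ ¬ IsSpecial p G ∧
      (M = Subgroup.zpowers ⁅a p, b p⁆ → IsMiller G) ∧
      (M = Subgroup.zpowers ⁅a p, d p⁆ → ¬ IsMiller G) := by
  obtain ⟨μ, hμ, rfl, ⟨e⟩⟩ := h.exists_mulEquiv hp hM
  have hcard : Nat.card G = p ^ 12 := by rw [← Nat.card_congr e.toEquiv, card_amalgamModel hp]
  refine ⟨IsPGroup.of_card hcard, hcard, fun hs => ?_, fun hab => ?_, fun had hG => ?_⟩
  · exact center_amalgamModel_ne_commutator hp μ (center_eq_commutator_of_mulEquiv e hs.2.1)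
  · obtain ⟨k, hk, hi⟩ := exists_coeff_of_zpowers_eq hp (HWord_ofComm_ab p) hμ hab
    refine (isMiller_amalgamModel hp hodd hk fun i => ?_).of_mulEquiv e
    rw [hi]
    fin_cases i <;> simp
  · obtain ⟨k, hk, hi⟩ := exists_coeff_of_zpowers_eq hp (HWord_ofComm_ad p) hμ had
    have := Fact.mk hp
    obtain ⟨k', hk'⟩ := ZMod.intCast_surjective k⁻¹
    refine not_isMiller_amalgamModel hp hodd (k' := k') (fun i => ?_) (hG.of_mulEquiv e.symm)
    rw [hi, hk', inv_mul_cancel_left₀ hk]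
    fin_cases i <;> simp

end Conclusion

end MillerGroups

theorem theoremB (p : ℕ) (hp : p.Prime) (hodd : p ≠ 2) :
    -- the prescribed action is by a non-inner central automorphism of `H`
    (∃ γ : MulAut (MillerGroups.H p),
      γ (MillerGroups.a p) = MillerGroups.a p * MillerGroups.d p ^ p ∧
      γ (MillerGroups.b p) = MillerGroups.b p ∧
      γ (MillerGroups.c p) = MillerGroups.c p ∧
      γ (MillerGroups.d p) = MillerGroups.d p ∧
      MillerGroups.IsCentralAut γ ∧ ¬ MillerGroups.IsInnerAut γ) ∧
    -- the two subgroups singled out below are allowed choices of `M`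
    MillerGroups.IsAdmissible p (Subgroup.zpowers ⁅MillerGroups.a p, MillerGroups.b p⁆) ∧
    MillerGroups.IsAdmissible p (Subgroup.zpowers ⁅MillerGroups.a p, MillerGroups.d p⁆) ∧
    ∀ M : Subgroup (MillerGroups.H p), MillerGroups.IsAdmissible p M →
      -- `H ⋊_M ⟨w⟩` exists
      (∃ (G : Type) (_ : Group G) (ι : MillerGroups.H p →* G) (w : G),
        MillerGroups.IsG₂ p M G ι w) ∧
      -- and every such group has the stated properties
      ∀ (G : Type u) [Group G] (ι : MillerGroups.H p →* G) (w : G),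
        MillerGroups.IsG₂ p M G ι w →
          IsPGroup p G ∧ Nat.card G = p ^ 12 ∧ ¬ MillerGroups.IsSpecial p G ∧
          (M = Subgroup.zpowers ⁅MillerGroups.a p, MillerGroups.b p⁆ →
            MillerGroups.IsMiller G) ∧
          (M = Subgroup.zpowers ⁅MillerGroups.a p, MillerGroups.d p⁆ →
            ¬ MillerGroups.IsMiller G) := by
  have := Fact.mk hp
  obtain ⟨γ, γa, γb, γc, γd, hγ⟩ := MillerGroups.exists_H_aut p
  refine ⟨⟨γ, γa, γb, γc, γd, hγ, MillerGroups.not_isInnerAut p hp γa⟩,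
    MillerGroups.isAdmissible_zpowers p hp hodd (MillerGroups.HWord_ofComm_ab p) (by simp),
    MillerGroups.isAdmissible_zpowers p hp hodd (MillerGroups.HWord_ofComm_ad p) (by simp),
    fun M hM => ⟨?_, fun G _ ι w h => h.properties hp hodd hM⟩⟩
  obtain ⟨μ, hμ, rfl⟩ := hM.exists_generator hp
  exact ⟨_, _, _, _, MillerGroups.isG₂_amalgamModel hp hμ⟩
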